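/- Let $\mathbb{K}$ be a field of characteristic $0$, $n\ge 0$, $S=\mathbb{K}[x_0,\dots,x_n]$ and $R=\mathbb{K}[x_1,\dots,x_n]$, with variables ordered $x_n>\dots>x_0$. The Hilbert polynomial of a homogeneous ideal $I$ of a polynomial ring $A$ is the polynomial $p$ with $p(t)=\dim_{\mathbb{K}} A_t/I_t$ for $t\gg 0$. An ideal $I$ is saturated if $I=I^{\mathrm{sat}}:=\{f : f\,\mathfrak{m}^k\subseteq I \text{ for some } k\}$, where $\mathfrak m$ is the ideal generated by the variables. A homogeneous ideal is Borel-fixed if it is fixed by all invertible upper triangular linear substitutions $x_i\mapsto\sum_{j\ge i}g_{ij}x_j$. A Borel set in degree $r$ is a set $B$ of monomials of degree $r$ in $S$ such that $x^\alpha\in B$ and $x_i\mid x^\alpha$, $i<n$, imply $\frac{x_{i+1}}{x_i}x^\alpha\in B$; it corresponds to $p(t)$ if $\langle B\rangle^{\mathrm{sat}}\subseteq S$ has Hilbert polynomial $p(t)$. The Gotzmann number of $p(t)$ is the number $r$ of terms in its Gotzmann decomposition $$p(t)=\sum_{i=1}^{r}\binom{t+a_i-(i-1)}{a_i},\qquad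 a_1\ge\dots\ge a_r\ge 0 .$$ Let $p(t)$ be the Hilbert polynomial of some homogeneous ideal of $S$, with Gotzmann number $r$, and let $r_1$ be the Gotzmann number of $\Delta p(t)=p(t)-p(t-1)$. For an ideal $J\subseteq R$, let $B_J$ be the set of monomials of degree $r$ in $J\cdot S$, and let $q_J=p(r)-N_J$, where $N_J$ is the number of monomials of degree $r$ in $S$ not in $B_J$. (i) Let $J\subseteq R$ be a saturated Borel-fixed ideal with Hilbert polynomial $\Delta p(t)$. Then $q_J\le r-r_1$. A Borel set corresponding to $p(t)$ can be obtained from $B_J$ by removing monomials if and only if $q_J\ge 0$, and whenever $B\subseteq B_J$ is such a Borel set, the number $|B_J\setminus B|$ of monomials removed equals $q_J$; in particular it is at most $r-r_1$. (ii) Let $L\subseteq R$ be the saturated lexicographic ideal with Hilbert polynomial $\Delta p(t)$ (a monomial ideal which with a monomial contains every lexicographically larger monomial of the same degree). Then a Borel set corresponding to $p(t)$ can be obtained from $B_L$ by removing monomials, and every such Borel set $B\subseteq B_L$ satisfies $|B_L\setminus B|=r-r_1$. -/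

import Mathlib

noncomputable section

namespace BorelRemoval

open MvPolynomial

attribute [local instance] MvPolynomial.gradedAlgebra

section Ideals

variable {σ K : Type*} [Field K]

/-- The dimension of the degree `t` piece `S_t / I_t`, where `S` is the polynomial ring in the
variables `σ` and `I_t = I ∩ S_t`. -/
def hilbertFunction (I : Ideal (MvPolynomial σ K)) (t : ℕ) : ℕ :=
  Module.finrank K
    (homogeneousSubmodule σ K t ⧸
      (Submodule.restrictScalars K I).comap (homogeneousSubmodule σ K t).subtype)

/-- `p` is the Hilbert polynomial of `S / I`: it agrees with the Hilbert function of `S / I` in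
all large degrees. -/
def IsHilbertPolynomial (I : Ideal (MvPolynomial σ K)) (p : Polynomial ℚ) : Prop :=
  ∀ᶠ t : ℕ in Filter.atTop, p.eval (t : ℚ) = (hilbertFunction I t : ℚ)

/-- The saturation `⋃ₖ (I : 𝔪ᵏ)` with respect to the ideal `𝔪` generated by the variables. -/
def saturation (I : Ideal (MvPolynomial σ K)) : Ideal (MvPolynomial σ K) where
  carrier := {f | ∃ k : ℕ, ∀ g ∈ idealOfVars σ K ^ k, f * g ∈ I}
  zero_mem' := ⟨0, fun g _ => by simp⟩
  add_mem' := by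
    rintro a b ⟨k, hk⟩ ⟨l, hl⟩
    refine ⟨max k l, fun g hg => ?_⟩
    rw [add_mul]
    exact I.add_mem (hk g (Ideal.pow_le_pow_right (le_max_left k l) hg))
      (hl g (Ideal.pow_le_pow_right (le_max_right k l) hg))
  smul_mem' := by
    rintro c a ⟨k, hk⟩
    refine ⟨k, fun g hg => ?_⟩
    rw [smul_eq_mul, mul_assoc]
    exact I.mul_mem_left c (hk g hg)

def IsSaturated (I : Ideal (MvPolynomial σ K)) : Prop :=
  saturation I = I

/-- The linear substitution `x_i ↦ ∑ j, g i j * x_j`. -/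
def linearSubst [Fintype σ] (g : Matrix σ σ K) : MvPolynomial σ K →ₐ[K] MvPolynomial σ K :=
  aeval fun i => ∑ j, C (g i j) * X j

/-- A homogeneous ideal is Borel-fixed if every invertible upper triangular linear change of
variables maps it onto itself. For `i < j` the matrix `1 + E_{i,j}` acts as `x_i ↦ x_i + x_j`. -/
def IsBorelFixed [Fintype σ] [LinearOrder σ] (I : Ideal (MvPolynomial σ K)) : Prop :=
  I.IsHomogeneous (homogeneousSubmodule σ K) ∧
    ∀ g : Matrix.GeneralLinearGroup σ K, (g : Matrix σ σ K).BlockTriangular id →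
      I.map (linearSubst (g : Matrix σ σ K)) = I

/-- The ideal generated by the monomials with exponents in `B`. -/
def monomialIdeal (K : Type*) [Field K] (B : Set (σ →₀ ℕ)) : Ideal (MvPolynomial σ K) :=
  Ideal.span ((fun α => monomial α (1 : K)) '' B)

end Ideals

/-- `α >_lex β` for exponent vectors, the variables being ordered increasingly with their index:
at the largest index where the exponents differ, `α` has the larger one. -/
def LexGT {n : ℕ} (α β : Fin n →₀ ℕ) : Prop :=
  ∃ i, β i < α i ∧ ∀ j, i < j → α j = β j

/-- A lexicographic ideal: a monomial ideal which with a monomial contains every lexicographically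
larger monomial of the same degree. -/
def IsLexIdeal {n : ℕ} {K : Type*} [Field K] (I : Ideal (MvPolynomial (Fin n) K)) : Prop :=
  (∃ A : Set (Fin n →₀ ℕ), I = monomialIdeal K A) ∧
    ∀ α β : Fin n →₀ ℕ, α.degree = β.degree → LexGT α β →
      monomial β (1 : K) ∈ I → monomial α (1 : K) ∈ I

/-- The extension of an ideal of `K[x_1, …, x_n]` to `K[x_0, …, x_n]`; the index `i : Fin n`
stands for the variable `x_{i+1}`, and the index `i : Fin (n + 1)` for `x_i`. -/
def extendIdeal {n : ℕ} {K : Type*} [Field K] (J : Ideal (MvPolynomial (Fin n) K)) :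
    Ideal (MvPolynomial (Fin (n + 1)) K) :=
  J.map (rename (Fin.succ : Fin n → Fin (n + 1)))

/-- The (exponents of the) monomials of degree `r` in `x_0, …, x_n`. -/
def pos (n r : ℕ) : Finset (Fin (n + 1) →₀ ℕ) :=
  Finset.finsuppAntidiag Finset.univ r

open Classical in
/-- The monomials of degree `r` that lie in the ideal `I`. -/
def monomialsIn {n : ℕ} {K : Type*} [Field K] (I : Ideal (MvPolynomial (Fin (n + 1)) K)) (r : ℕ) :
    Finset (Fin (n + 1) →₀ ℕ) :=
  (pos n r).filter fun α => monomial α (1 : K) ∈ I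

/-- A Borel set in degree `r`: a set of monomials of degree `r` closed under all the admissible
increasing elementary moves `x^α ↦ (x_{i+1} / x_i) x^α`. -/
def IsBorelSet {n : ℕ} (r : ℕ) (B : Finset (Fin (n + 1) →₀ ℕ)) : Prop :=
  B ⊆ pos n r ∧
    ∀ α ∈ B, ∀ i : Fin n, α i.castSucc ≠ 0 →
      α - Finsupp.single i.castSucc 1 + Finsupp.single i.succ 1 ∈ B

/-- `B` is a Borel set in degree `r` corresponding to the Hilbert polynomial `p`: the saturation
of the ideal generated by `B` has Hilbert polynomial `p`. -/
def IsBorelSetFor (K : Type*) [Field K] {n : ℕ} (p : Polynomial ℚ) (r : ℕ)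
    (B : Finset (Fin (n + 1) →₀ ℕ)) : Prop :=
  IsBorelSet r B ∧
    IsHilbertPolynomial (saturation (monomialIdeal K (B : Set (Fin (n + 1) →₀ ℕ)))) p

/-- `p` is the Hilbert polynomial of some homogeneous ideal of `K[x_0, …, x_n]`. -/
def IsAdmissible (K : Type*) [Field K] (n : ℕ) (p : Polynomial ℚ) : Prop :=
  ∃ I : Ideal (MvPolynomial (Fin (n + 1)) K),
    I.IsHomogeneous (homogeneousSubmodule (Fin (n + 1)) K) ∧ IsHilbertPolynomial I p

/-- `r` is the Gotzmann number of `p`, the number of terms of the Gotzmann decomposition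
`p(t) = ∑_{i < r} binom (t + a_i - i) (a_i)` with `a_0 ≥ a_1 ≥ … ≥ a_{r-1} ≥ 0`. Here
`Polynomial.preHilbertPoly ℚ a i` is the polynomial `binom (t + a - i) a` in `t`. -/
def IsGotzmannNumber (p : Polynomial ℚ) (r : ℕ) : Prop :=
  ∃ a : Fin r → ℕ, Antitone a ∧ p = ∑ i : Fin r, Polynomial.preHilbertPoly ℚ (a i) i

/-- The first difference `p(t) - p(t - 1)`. -/
def firstDiff (p : Polynomial ℚ) : Polynomial ℚ :=
  p - p.comp (Polynomial.X - 1)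

end BorelRemoval

end

open BorelRemoval

/-!
Strongly stable monomial ideals are handled through their sets of exponents. In characteristic
zero a Borel-fixed ideal is monomial and strongly stable: elements of the torus separate the
monomials of a polynomial, and `x_i ↦ x_i + x_j` performs the elementary moves
(`IsBorelFixed.isMonomialIdeal`, `IsBorelFixed.isStable`). From there on the argument counts
monomials.

A Gotzmann decomposition is a decreasing list `l`, and `gotzmannFunction l` is the Hilbert function
of the corresponding saturated lexicographic ideal. Taking first differences deletes the zeros of
the list and lowers the other entries (`gotzmannFunction_eq_sum_lowerList`). This gives the
uniqueness of the decomposition (`gotzmannFunction_eventually_injective`), and shows that `r - r₁`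
is the number of zeros in the decomposition of `p`.

The central fact is `hilbertCount_bounds`. A saturated stable ideal with Gotzmann list `l` has
Hilbert function at least `gotzmannFunction l`, with equality from degree `l.length - 1` on, and is
generated in degrees at most `l.length`. The proof is by induction on the number of variables. The
Hilbert function is the sum of that of the section by the smallest variable, and the section is
compared with its saturation `V`, to which induction applies. The excess of the section over the
bound for `V` has as total the number of zeros in the list. Once it vanishes in a degree beyond the
generators of `V`, the section and `V` agree from there on, so it vanishes forever. Hence the
excess is at least one in each degree until it is used up.

For a Borel set `B` in degree `r`, the saturation of the ideal generated by `B` meets degree `r` in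
`B` alone. So `B` corresponds to `p` only if exactly `p(r)` monomials lie outside of `B`, which
determines the number of monomials removed. The bound above, summed over the degrees up to `r`,
yields `q_J ≤ r - r₁`. For existence, one removes from `B_J` multiples of `x_0` of smallest weight,
which keeps the set Borel and raises the Hilbert polynomial by one for each monomial
(`IsBorelSet.hilbertCount_removal`). There are enough of them because
`p(r - 1) ≤ binom (n + r - 1) n`, which is where it matters that `p` is the Hilbert polynomial of
an ideal (`exists_isBorelSet_of_le`).

A saturated lexicographic ideal has Hilbert function exactly `gotzmannFunction l`, so that
`q_L = r - r₁`. The recursion defining `gotzmannFunction` counts the monomials of `lexTail l`, the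
complement of a lexicographic ideal, which is insensitive to the smallest variable. The two ideals
have the same Hilbert function in large degrees, hence agree there, and by saturation everywhere
(`hilbertCount_le_of_lex`).
-/

noncomputable section

namespace BorelRemoval

section
/-! ### Gotzmann decompositions -/

/-- The function `d ↦ ∑ binom (d - i + b_i) (b_i)`, the sum over the positions `i ≤ d` of the list
`b_0, b_1, …`, so that no binomial coefficient with a negative upper part occurs. -/
def gotzmannFunction : List ℕ → ℕ → ℕ
  | [], _ => 0
  | b :: _, 0 => b.choose b
  | b :: l, d + 1 => (d + 1 + b).choose b + gotzmannFunction l d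

/-- The list obtained from `l` by dropping the zeros and lowering every other entry by one. -/
def lowerList : List ℕ → List ℕ
  | [] => []
  | 0 :: l => lowerList l
  | (b + 1) :: l => b :: lowerList l

@[simp] lemma gotzmannFunction_nil (d : ℕ) : gotzmannFunction [] d = 0 := by
  cases d <;> rfl

lemma gotzmannFunction_cons_succ (b : ℕ) (l : List ℕ) (d : ℕ) :
    gotzmannFunction (b :: l) (d + 1) = (d + 1 + b).choose b + gotzmannFunction l d := rfl

@[simp] lemma gotzmannFunction_cons_zero (b : ℕ) (l : List ℕ) :
    gotzmannFunction (b :: l) 0 = 1 := by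
  simp [gotzmannFunction]

lemma gotzmannFunction_singleton (b d : ℕ) : gotzmannFunction [b] d = (d + b).choose b := by
  cases d <;> simp [gotzmannFunction]

lemma length_lowerList_le (l : List ℕ) : (lowerList l).length ≤ l.length := by
  induction l with
  | nil => simp [lowerList]
  | cons b l ih => cases b <;> simp [lowerList] <;> omega

lemma mem_lowerList {l : List ℕ} {x : ℕ} : x ∈ lowerList l ↔ x + 1 ∈ l := by
  induction l with
  | nil => simp [lowerList]
  | cons b l ih => cases b <;> simp [lowerList, ih]

lemma pairwise_lowerList {l : List ℕ} (hl : l.Pairwise (· ≥ ·)) :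
    (lowerList l).Pairwise (· ≥ ·) := by
  induction l with
  | nil => simp [lowerList]
  | cons b l ih =>
    rw [List.pairwise_cons] at hl
    cases b with
    | zero => exact ih hl.2
    | succ b =>
      refine List.pairwise_cons.2 ⟨fun x hx => ?_, ih hl.2⟩
      have := hl.1 _ (mem_lowerList.1 hx)
      omega

lemma eq_replicate_of_zero_cons {l : List ℕ} (hl : (0 :: l).Pairwise (· ≥ ·)) :
    l = List.replicate l.length 0 := by
  rw [List.eq_replicate_iff]
  exact ⟨rfl, fun b hb => Nat.le_zero.1 ((List.pairwise_cons.1 hl).1 b hb)⟩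

lemma lowerList_replicate_zero (k : ℕ) : lowerList (List.replicate k 0) = [] := by
  induction k with
  | zero => rfl
  | succ k ih => simpa [List.replicate_succ, lowerList] using ih

lemma gotzmannFunction_replicate_zero (k d : ℕ) :
    gotzmannFunction (List.replicate k 0) d = min k (d + 1) := by
  induction d generalizing k with
  | zero => cases k <;> simp [List.replicate_succ]
  | succ d ih =>
    cases k with
    | zero => simp
    | succ k =>
      rw [List.replicate_succ, gotzmannFunction_cons_succ, ih, Nat.choose_zero_right]
      omega

/-- A decreasing list is recovered from its lowering and the number of its zeros. -/
lemma eq_map_succ_lowerList_append {l : List ℕ} (hl : l.Pairwise (· ≥ ·)) :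
    l = (lowerList l).map (· + 1) ++ List.replicate (l.length - (lowerList l).length) 0 := by
  induction l with
  | nil => simp [lowerList]
  | cons b l ih =>
    cases b with
    | zero =>
      have h := eq_replicate_of_zero_cons hl
      rw [h, lowerList, lowerList_replicate_zero]
      simp [List.replicate_succ]
    | succ b =>
      have := ih (List.pairwise_cons.1 hl).2
      simp only [lowerList, List.map_cons, List.cons_append, List.length_cons,
        Nat.add_sub_add_right]
      rw [← this]

lemma sum_range_add_choose_self (b d : ℕ) :
    ∑ j ∈ Finset.range (d + 1), (j + b).choose b = (d + (b + 1)).choose (b + 1) := by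
  rw [Nat.sum_range_add_choose, add_assoc]

/-- Summation raises every entry of the list by one; each zero of the list contributes one more
as soon as its position is reached. -/
lemma gotzmannFunction_eq_sum_lowerList {l : List ℕ} (hl : l.Pairwise (· ≥ ·)) (d : ℕ) :
    gotzmannFunction l d = ∑ j ∈ Finset.range (d + 1), gotzmannFunction (lowerList l) j +
      min (l.length - (lowerList l).length) (d + 1 - (lowerList l).length) := by
  induction l generalizing d with
  | nil => simp [lowerList]
  | cons b l ih =>
    cases b with
    | zero =>
      have h := eq_replicate_of_zero_cons hl
      rw [h, lowerList, lowerList_replicate_zero, ← List.replicate_succ,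
        gotzmannFunction_replicate_zero]
      simp
    | succ b =>
      cases d with
      | zero => simp [lowerList]
      | succ d =>
        rw [gotzmannFunction_cons_succ, ih (List.pairwise_cons.1 hl).2 d, lowerList,
          ← sum_range_add_choose_self, Finset.sum_range_succ' _ (d + 1),
          Finset.sum_range_succ' _ (d + 1)]
        simp only [gotzmannFunction_cons_succ, gotzmannFunction_cons_zero,
          Finset.sum_add_distrib, List.length_cons, zero_add, Nat.choose_self]
        omega

lemma gotzmannFunction_succ_of_length_le {l : List ℕ} (hl : l.Pairwise (· ≥ ·)) {d : ℕ}
    (hd : l.length ≤ d + 1) :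
    gotzmannFunction l (d + 1) = gotzmannFunction l d + gotzmannFunction (lowerList l) (d + 1) := by
  have := length_lowerList_le l
  rw [gotzmannFunction_eq_sum_lowerList hl, gotzmannFunction_eq_sum_lowerList hl d,
    Finset.sum_range_succ]
  omega

lemma one_le_gotzmannFunction_cons (b : ℕ) (l : List ℕ) (d : ℕ) :
    1 ≤ gotzmannFunction (b :: l) d := by
  cases d with
  | zero => simp
  | succ d =>
    rw [gotzmannFunction_cons_succ]
    have : 0 < (d + 1 + b).choose b := Nat.choose_pos (by omega)
    omega

open Filter

lemma eq_nil_of_eventually_gotzmannFunction_eq_zero {l : List ℕ}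
    (h : ∀ᶠ t in atTop, gotzmannFunction l t = 0) : l = [] := by
  obtain ⟨t, ht⟩ := h.exists
  cases l with
  | nil => rfl
  | cons b l => have := one_le_gotzmannFunction_cons b l t; omega

/-- The Gotzmann decomposition is unique: taking first differences lowers the entries, so one
inducts on a bound for them, and the number of zeros is the remaining constant. -/
theorem gotzmannFunction_eventually_injective {l l' : List ℕ} (hl : l.Pairwise (· ≥ ·))
    (hl' : l'.Pairwise (· ≥ ·))
    (h : ∀ᶠ t in atTop, gotzmannFunction l t = gotzmannFunction l' t) : l = l' := by
  suffices H : ∀ N : ℕ, ∀ l l' : List ℕ, (∀ x ∈ l, x < N) → (∀ x ∈ l', x < N) →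
      l.Pairwise (· ≥ ·) → l'.Pairwise (· ≥ ·) →
      (∀ᶠ t in atTop, gotzmannFunction l t = gotzmannFunction l' t) → l = l' by
    refine H (l.sum + l'.sum + 1) l l' (fun x hx => ?_) (fun x hx => ?_) hl hl' h
    · have := List.single_le_sum (fun _ _ => Nat.zero_le _) x hx; omega
    · have := List.single_le_sum (fun _ _ => Nat.zero_le _) x hx; omega
  intro N
  induction N with
  | zero =>
    intro l l' h1 h2 _ _ _
    rw [List.eq_nil_iff_forall_not_mem.2 fun x hx => Nat.not_lt_zero x (h1 x hx),
      List.eq_nil_iff_forall_not_mem.2 fun x hx => Nat.not_lt_zero x (h2 x hx)]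
  | succ N ih =>
    intro l l' h1 h2 hl hl' h
    have hlow : lowerList l = lowerList l' := by
      refine ih _ _ (fun x hx => ?_) (fun x hx => ?_) (pairwise_lowerList hl)
        (pairwise_lowerList hl') ?_
      · have := h1 _ (mem_lowerList.1 hx); omega
      · have := h2 _ (mem_lowerList.1 hx); omega
      · obtain ⟨t₀, ht₀⟩ := eventually_atTop.1 h
        refine eventually_atTop.2 ⟨t₀ + l.length + l'.length + 1, fun t ht => ?_⟩
        obtain ⟨t, rfl⟩ : ∃ s, t = s + 1 := ⟨t - 1, by omega⟩
        have e1 := gotzmannFunction_succ_of_length_le hl (d := t) (by omega)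
        have e2 := gotzmannFunction_succ_of_length_le hl' (d := t) (by omega)
        have e3 := ht₀ t (by omega)
        have e4 := ht₀ (t + 1) (by omega)
        omega
    obtain ⟨t₀, ht₀⟩ := eventually_atTop.1 h
    have e1 := gotzmannFunction_eq_sum_lowerList hl (t₀ + l.length + l'.length)
    have e2 := gotzmannFunction_eq_sum_lowerList hl' (t₀ + l.length + l'.length)
    have e3 := ht₀ (t₀ + l.length + l'.length) (by omega)
    have l1 := length_lowerList_le l
    have l2 := length_lowerList_le l'
    have e4 : l.length = l'.length := by
      rw [hlow] at e1 l1
      omega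
    rw [eq_map_succ_lowerList_append hl, eq_map_succ_lowerList_append hl', hlow, e4]

lemma add_choose_mono (t b k : ℕ) : (t + b).choose b ≤ (t + (b + k)).choose (b + k) := by
  induction k with
  | zero => simp
  | succ k ih =>
    rw [← add_assoc b k 1, ← add_assoc t, Nat.choose_succ_succ]
    exact ih.trans (Nat.le_add_right _ _)

lemma gotzmannFunction_eventually_le_choose {l : List ℕ} (hl : l.Pairwise (· ≥ ·)) {n : ℕ}
    (h : ∀ᶠ t in atTop, gotzmannFunction l t ≤ (t + n).choose n) :
    l = [n] ∨ ∀ x ∈ l, x < n := by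
  obtain ⟨t, ht⟩ := eventually_atTop.1 h
  cases l with
  | nil => simp
  | cons b l =>
    have ht1 := ht (t + 1) (by omega)
    rw [gotzmannFunction_cons_succ] at ht1
    rcases lt_trichotomy b n with hb | rfl | hb
    · right
      intro x hx
      rcases List.mem_cons.1 hx with rfl | hx
      · exact hb
      · exact lt_of_le_of_lt ((List.pairwise_cons.1 hl).1 x hx) hb
    · left
      cases l with
      | nil => rfl
      | cons c l => have := one_le_gotzmannFunction_cons c l t; omega
    · exfalso
      obtain ⟨k, rfl⟩ : ∃ k, b = n + 1 + k := ⟨b - n - 1, by omega⟩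
      have h1 := add_choose_mono (t + 1) (n + 1) k
      have h2 : (t + 1 + (n + 1)).choose (n + 1) =
          (t + 1 + n).choose n + (t + 1 + n).choose (n + 1) := by
        rw [← add_assoc, Nat.choose_succ_succ]
      have h3 : 0 < (t + 1 + n).choose (n + 1) := Nat.choose_pos (by omega)
      omega

lemma gotzmannFunction_le_choose {l : List ℕ} {n : ℕ} (h : l = [n] ∨ ∀ x ∈ l, x < n) (d : ℕ) :
    gotzmannFunction l d ≤ (d + n).choose n := by
  rcases h with rfl | h
  · rw [gotzmannFunction_singleton]
  induction l generalizing d with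
  | nil => simp
  | cons b l ih =>
    cases d with
    | zero => simp
    | succ d =>
      obtain ⟨k, rfl⟩ : ∃ k, n = b + k + 1 := ⟨n - b - 1, by have := h b (by simp); omega⟩
      have h1 := ih d fun x hx => h x (by simp [hx])
      have h2 := add_choose_mono (d + 1) b k
      have h3 : (d + 1 + (b + k + 1)).choose (b + k + 1) =
          (d + 1 + (b + k)).choose (b + k) + (d + (b + k + 1)).choose (b + k + 1) := by
        rw [← add_assoc, Nat.choose_succ_succ]
        congr 2
        omega
      rw [gotzmannFunction_cons_succ]
      omega

open Polynomial

lemma sum_eval_preHilbertPoly {r : ℕ} (a : Fin r → ℕ) {c d : ℕ} (hd : r + c ≤ d + 1) :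
    ∑ i : Fin r, (preHilbertPoly ℚ (a i) (i + c)).eval (d : ℚ) =
      gotzmannFunction (List.ofFn a) (d - c) := by
  induction r generalizing c with
  | zero => simp
  | succ r ih =>
    have h := ih (fun i => a i.succ) (c := c + 1) (by omega)
    have hc : c ≤ d := by omega
    rw [Fin.sum_univ_succ, List.ofFn_succ]
    simp only [Fin.val_zero, zero_add, Fin.val_succ, add_right_comm _ 1 c, add_assoc _ c 1]
    rw [h, preHilbertPoly_eq_choose_sub_add _ _ hc]
    obtain ⟨k, rfl⟩ := Nat.exists_eq_add_of_le hc
    cases k with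
    | zero =>
      obtain rfl : r = 0 := by omega
      simp
    | succ k =>
      rw [show c + (k + 1) - c = k + 1 by omega, show c + (k + 1) - (c + 1) = k by omega,
        gotzmannFunction_cons_succ]
      push_cast
      rfl

/-- A polynomial with Gotzmann number `r` agrees with the function of a decreasing list of length
`r` in all degrees `d ≥ r - 1`. -/
lemma IsGotzmannNumber.exists_list {p : ℚ[X]} {r : ℕ} (h : IsGotzmannNumber p r) :
    ∃ l : List ℕ, l.Pairwise (· ≥ ·) ∧ l.length = r ∧
      ∀ d : ℕ, r ≤ d + 1 → p.eval (d : ℚ) = gotzmannFunction l d := by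
  obtain ⟨a, ha, rfl⟩ := h
  refine ⟨List.ofFn a, List.pairwise_ofFn.2 fun i j hij => ha hij.le, by simp, fun d hd => ?_⟩
  rw [eval_finsetSum]
  exact sum_eval_preHilbertPoly a (c := 0) (by omega)

end

section
open Finsupp Filter

/-! ### Stable sets of exponent vectors -/

/-- The set of exponents of a strongly stable monomial ideal: it is closed under multiplication by
monomials and under replacing a variable by a larger one. -/
structure IsStable {m : ℕ} (U : Set (Fin m →₀ ℕ)) : Prop where
  add_mem : ∀ α ∈ U, ∀ β, α + β ∈ U
  move_mem : ∀ γ, ∀ i j : Fin m, i < j → γ + single i 1 ∈ U → γ + single j 1 ∈ U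

/-- The exponents of the saturation of the monomial ideal with exponents `U`. In zero variables
there is no exponent of positive degree, and the saturation is everything. -/
def satSet {m : ℕ} (U : Set (Fin m →₀ ℕ)) : Set (Fin m →₀ ℕ) :=
  {α | ∃ k : ℕ, ∀ β : Fin m →₀ ℕ, β.degree = k → α + β ∈ U}

open Classical in
/-- The number of monomials of degree `d` outside of `U`. -/
def hilbertCount {m : ℕ} (U : Set (Fin m →₀ ℕ)) (d : ℕ) : ℕ :=
  ((Finset.univ.finsuppAntidiag d).filter (· ∉ U)).card

/-- The exponents of the extension of a monomial ideal to one more, smallest, variable. -/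
def coneSet {m : ℕ} (U : Set (Fin m →₀ ℕ)) : Set (Fin (m + 1) →₀ ℕ) :=
  {α | tail α ∈ U}

/-- No minimal generator of the monomial ideal with exponents `U` has degree larger than `s`. -/
def GeneratedUpTo {m : ℕ} (U : Set (Fin m →₀ ℕ)) (s : ℕ) : Prop :=
  ∀ α ∈ U, s < α.degree → ∃ γ ∈ U, ∃ i, α = γ + single i 1

variable {m : ℕ}

lemma mem_finsuppAntidiag_univ {α : Fin m →₀ ℕ} {d : ℕ} :
    α ∈ Finset.univ.finsuppAntidiag d ↔ α.degree = d := by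
  simp [Finset.mem_finsuppAntidiag, degree_eq_sum]

lemma exists_eq_add_single {α : Fin m →₀ ℕ} {i : Fin m} (h : α i ≠ 0) :
    ∃ γ, α = γ + single i 1 := by
  refine ⟨α - single i 1, (tsub_add_cancel_of_le ?_).symm⟩
  simpa [Nat.one_le_iff_ne_zero] using h

lemma exists_apply_ne_zero {α : Fin m →₀ ℕ} (h : α.degree ≠ 0) : ∃ i, α i ≠ 0 := by
  by_contra! H
  exact h ((degree_eq_zero_iff α).2 (Finsupp.ext H))

lemma tail_add (α β : Fin (m + 1) →₀ ℕ) : tail (α + β) = tail α + tail β := by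
  ext i; simp [tail_apply]

lemma tail_single_zero (k : ℕ) : tail (single (0 : Fin (m + 1)) k) = 0 := by
  ext i; simp [tail_apply]

lemma tail_single_succ (i : Fin m) (k : ℕ) : tail (single i.succ k) = single i k := by
  rw [← cons_zero_single_eq_single_succ, tail_cons]

lemma degree_cons (k : ℕ) (β : Fin m →₀ ℕ) : (cons k β).degree = k + β.degree := by
  simp [degree_eq_sum, Fin.sum_univ_succ]

lemma degree_eq_add_degree_tail (α : Fin (m + 1) →₀ ℕ) : α.degree = α 0 + (tail α).degree := by
  conv_lhs => rw [← cons_tail α, degree_cons]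

lemma cons_add_single_zero (k l : ℕ) (β : Fin m →₀ ℕ) :
    cons k β + single 0 l = cons (k + l) β := by
  ext i
  refine Fin.cases ?_ (fun i => ?_) i <;> simp

lemma cons_add (k : ℕ) (β γ : Fin m →₀ ℕ) : cons k (β + γ) = cons k β + cons 0 γ := by
  ext i
  refine Fin.cases ?_ (fun i => ?_) i <;> simp

lemma IsStable.mem_of_le {U : Set (Fin m →₀ ℕ)} (hU : IsStable U) {α β : Fin m →₀ ℕ}
    (h : α ≤ β) (hα : α ∈ U) : β ∈ U := by
  obtain ⟨γ, rfl⟩ := exists_add_of_le h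
  exact hU.add_mem _ hα _

lemma subset_satSet {U : Set (Fin m →₀ ℕ)} (hU : IsStable U) : U ⊆ satSet U :=
  fun _ hα => ⟨0, fun _ _ => hU.add_mem _ hα _⟩

lemma IsStable.satSet {U : Set (Fin m →₀ ℕ)} (hU : IsStable U) : IsStable (satSet U) where
  add_mem := by
    rintro α ⟨k, hk⟩ β
    refine ⟨k, fun γ hγ => ?_⟩
    rw [add_right_comm]
    exact hU.add_mem _ (hk γ hγ) _
  move_mem := by
    rintro γ i j hij ⟨k, hk⟩
    refine ⟨k, fun δ hδ => ?_⟩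
    rw [add_right_comm]
    refine hU.move_mem _ i j hij ?_
    rw [add_right_comm]
    exact hk δ hδ

lemma satSet_satSet_subset {U : Set (Fin m →₀ ℕ)} (hU : IsStable U) :
    satSet (satSet U) ⊆ satSet U := by
  rintro α ⟨k, hk⟩
  have hfin : {β : Fin m →₀ ℕ | β.degree = k}.Finite := finite_of_degree_eq k
  have h : ∀ᶠ l in atTop, ∀ β ∈ {β : Fin m →₀ ℕ | β.degree = k},
      ∀ γ : Fin m →₀ ℕ, γ.degree = l → α + β + γ ∈ U := by
    rw [eventually_all_finite hfin]
    intro β hβ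
    obtain ⟨l, hl⟩ := hk β hβ
    filter_upwards [eventually_ge_atTop l] with l' hl' γ hγ
    obtain ⟨δ, hδ, hδl⟩ := exists_le_degree_eq γ l (by omega)
    exact hU.mem_of_le (add_le_add_right hδ _) (hl δ hδl)
  obtain ⟨l, hl⟩ := h.exists
  refine ⟨k + l, fun β hβ => ?_⟩
  obtain ⟨δ, hδ, hδk⟩ := exists_le_degree_eq β k (by omega)
  obtain ⟨ε, rfl⟩ := exists_add_of_le hδ
  rw [← add_assoc]
  refine hl δ hδk ε ?_
  rw [map_add] at hβ
  omega

/-- By Dickson's lemma a monomial ideal and its saturation differ in finitely many degrees. -/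
lemma eventually_mem_of_mem_satSet {U : Set (Fin m →₀ ℕ)} (hU : IsStable U) :
    ∀ᶠ t in atTop, ∀ α : Fin m →₀ ℕ, α.degree = t → α ∈ satSet U → α ∈ U := by
  have hfin : {g | Minimal (· ∈ satSet U) g}.Finite :=
    WellQuasiOrderedLE.finite_of_isAntichain (setOfPred_minimal_antichain _)
  have h : ∀ᶠ t in atTop, ∀ g ∈ {g | Minimal (· ∈ satSet U) g},
      ∀ α : Fin m →₀ ℕ, α.degree = t → g ≤ α → α ∈ U := by
    rw [eventually_all_finite hfin]
    intro g hg
    obtain ⟨k, hk⟩ := hg.prop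
    filter_upwards [eventually_ge_atTop (g.degree + k)] with t ht α hα hle
    obtain ⟨δ, rfl⟩ := exists_add_of_le hle
    rw [map_add] at hα
    obtain ⟨ε, hε, hεk⟩ := exists_le_degree_eq δ k (by omega)
    exact hU.mem_of_le (add_le_add_right hε _) (hk ε hεk)
  filter_upwards [h] with t ht α hα hmem
  obtain ⟨g, hle, hg⟩ := exists_minimal_le_of_wellFoundedLT (· ∈ satSet U) α hmem
  exact ht g hg α hα hle

lemma IsStable.add_mem_of_add_single_zero {U : Set (Fin (m + 1) →₀ ℕ)} (hU : IsStable U) {k : ℕ}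
    {γ β : Fin (m + 1) →₀ ℕ} (hβ : β.degree = k) (h : γ + single 0 k ∈ U) : γ + β ∈ U := by
  induction k generalizing γ β with
  | zero => rwa [(degree_eq_zero_iff β).1 hβ, ← single_zero 0]
  | succ k ih =>
    obtain ⟨j, hj⟩ := exists_apply_ne_zero (α := β) (by omega)
    obtain ⟨β, rfl⟩ := exists_eq_add_single hj
    rw [map_add, degree_single] at hβ
    rw [single_add, ← add_assoc] at h
    rw [add_comm β, ← add_assoc]
    refine ih (by omega) ?_
    rw [add_right_comm]
    rcases Fin.eq_zero_or_eq_succ j with rfl | ⟨i, rfl⟩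
    · exact h
    · exact hU.move_mem _ 0 _ (Fin.succ_pos i) h

/-- For a stable set, saturation only concerns the smallest variable. -/
lemma mem_satSet_iff {U : Set (Fin (m + 1) →₀ ℕ)} (hU : IsStable U) {α : Fin (m + 1) →₀ ℕ} :
    α ∈ satSet U ↔ ∃ k, α + single 0 k ∈ U :=
  ⟨fun ⟨k, hk⟩ => ⟨k, hk _ (degree_single _ _)⟩,
    fun ⟨k, hk⟩ => ⟨k, fun _ hβ => hU.add_mem_of_add_single_zero hβ hk⟩⟩

lemma mem_of_add_single_zero_mem {U : Set (Fin (m + 1) →₀ ℕ)} (hU : IsStable U)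
    (hsat : satSet U ⊆ U) {α : Fin (m + 1) →₀ ℕ} {k : ℕ} (h : α + single 0 k ∈ U) : α ∈ U :=
  hsat ((mem_satSet_iff hU).2 ⟨k, h⟩)

lemma IsStable.coneSet {U : Set (Fin m →₀ ℕ)} (hU : IsStable U) : IsStable (coneSet U) where
  add_mem α hα β := by
    change tail (α + β) ∈ U
    rw [tail_add]
    exact hU.add_mem _ hα _
  move_mem γ i j hij h := by
    change tail (γ + single j 1) ∈ U
    replace h : tail (γ + single i 1) ∈ U := h
    rw [tail_add] at h ⊢
    obtain ⟨j, rfl⟩ : ∃ j', j = Fin.succ j' := Fin.exists_succ_eq.2 (Fin.ne_zero_of_lt hij) |>.imp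
      fun _ h => h.symm
    rw [tail_single_succ]
    rcases Fin.eq_zero_or_eq_succ i with rfl | ⟨i, rfl⟩
    · rw [tail_single_zero, add_zero] at h
      exact hU.add_mem _ h _
    · rw [tail_single_succ] at h
      exact hU.move_mem _ i j (Fin.succ_lt_succ_iff.1 hij) h

lemma satSet_coneSet_subset {U : Set (Fin m →₀ ℕ)} (hU : IsStable U) :
    satSet (coneSet U) ⊆ coneSet U := by
  intro α hα
  obtain ⟨k, hk⟩ := (mem_satSet_iff hU.coneSet).1 hα
  change tail (α + single 0 k) ∈ U at hk
  rwa [tail_add, tail_single_zero, add_zero] at hk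

/-- The section of `U` by the hyperplane where the smallest variable vanishes. -/
def sectionSet (U : Set (Fin (m + 1) →₀ ℕ)) : Set (Fin m →₀ ℕ) := {β | cons 0 β ∈ U}

lemma IsStable.sectionSet {U : Set (Fin (m + 1) →₀ ℕ)} (hU : IsStable U) :
    IsStable (sectionSet U) where
  add_mem α hα β := by
    change cons 0 (α + β) ∈ U
    rw [cons_add]
    exact hU.add_mem _ hα _
  move_mem γ i j hij h := by
    change cons 0 (γ + single j 1) ∈ U
    replace h : cons 0 (γ + single i 1) ∈ U := h
    rw [cons_add, cons_zero_single_eq_single_succ] at h ⊢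
    exact hU.move_mem _ _ _ (Fin.succ_lt_succ_iff.2 hij) h

lemma coneSet_sectionSet {U : Set (Fin (m + 1) →₀ ℕ)} (hU : IsStable U) (hsat : satSet U ⊆ U) :
    coneSet (sectionSet U) = U := by
  ext α
  change cons 0 (tail α) ∈ U ↔ α ∈ U
  have h : α = cons 0 (tail α) + single 0 (α 0) := by
    rw [cons_add_single_zero, zero_add, cons_tail]
  constructor
  · intro hα
    rw [h]
    exact hU.add_mem _ hα _
  · intro hα
    rw [h] at hα
    exact mem_of_add_single_zero_mem hU hsat hα

lemma hilbertCount_coneSet (U : Set (Fin m →₀ ℕ)) (d : ℕ) :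
    hilbertCount (coneSet U) d = ∑ j ∈ Finset.range (d + 1), hilbertCount U j := by
  classical
  unfold hilbertCount
  rw [← Finset.card_sigma]
  refine Finset.card_bij' (fun α _ => ⟨(tail α).degree, tail α⟩)
    (fun x _ => cons (d - x.1) x.2) ?_ ?_ ?_ ?_
  · intro α hα
    rw [Finset.mem_filter, mem_finsuppAntidiag_univ, degree_eq_add_degree_tail] at hα
    simp only [Finset.mem_sigma, Finset.mem_range, Finset.mem_filter, mem_finsuppAntidiag_univ,
      true_and]
    exact ⟨by omega, hα.2⟩
  · rintro ⟨j, β⟩ hβ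
    simp only [Finset.mem_sigma, Finset.mem_range, Finset.mem_filter,
      mem_finsuppAntidiag_univ] at hβ
    rw [Finset.mem_filter, mem_finsuppAntidiag_univ, degree_cons]
    refine ⟨by simp only; omega, ?_⟩
    change tail (cons _ β) ∉ U
    rw [tail_cons]
    exact hβ.2.2
  · intro α hα
    rw [Finset.mem_filter, mem_finsuppAntidiag_univ, degree_eq_add_degree_tail] at hα
    have : d - (tail α).degree = α 0 := by omega
    simp only [this, cons_tail]
  · rintro ⟨j, β⟩ hβ
    simp only [Finset.mem_sigma, Finset.mem_range, Finset.mem_filter,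
      mem_finsuppAntidiag_univ] at hβ
    obtain ⟨_, rfl, _⟩ := hβ
    simp

lemma hilbertCount_empty (n d : ℕ) :
    hilbertCount (∅ : Set (Fin (n + 1) →₀ ℕ)) d = (d + n).choose n := by
  induction n generalizing d with
  | zero =>
    have h : (∅ : Set (Fin (0 + 1) →₀ ℕ)) = coneSet ∅ := rfl
    rw [h, hilbertCount_coneSet, Finset.sum_range_succ']
    simp [hilbertCount]
  | succ n ih =>
    have h : (∅ : Set (Fin (n + 1 + 1) →₀ ℕ)) = coneSet ∅ := rfl
    rw [h, hilbertCount_coneSet, ← sum_range_add_choose_self]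
    exact Finset.sum_congr rfl fun j _ => ih j

lemma hilbertCount_anti {U V : Set (Fin m →₀ ℕ)} (h : U ⊆ V) (d : ℕ) :
    hilbertCount V d ≤ hilbertCount U d := by
  classical
  exact Finset.card_le_card (Finset.monotone_filter_right _ fun _ _ hα hαU => hα (h hαU))

lemma hilbertCount_congr {U V : Set (Fin m →₀ ℕ)} {d : ℕ}
    (h : ∀ α : Fin m →₀ ℕ, α.degree = d → (α ∈ U ↔ α ∈ V)) :
    hilbertCount U d = hilbertCount V d := by
  classical
  unfold hilbertCount
  congr 1
  refine Finset.filter_congr fun α hα => ?_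
  rw [h α (mem_finsuppAntidiag_univ.1 hα)]

lemma hilbertCount_lt {U V : Set (Fin m →₀ ℕ)} {β : Fin m →₀ ℕ} (hβV : β ∈ V) (hβU : β ∉ U)
    (h : ∀ α : Fin m →₀ ℕ, α.degree = β.degree → α ∈ U → α ∈ V) :
    hilbertCount V β.degree < hilbertCount U β.degree := by
  classical
  unfold hilbertCount
  refine Finset.card_lt_card ((Finset.ssubset_iff_of_subset fun γ hγ => ?_).2
    ⟨β, Finset.mem_filter.2 ⟨mem_finsuppAntidiag_univ.2 rfl, hβU⟩, fun H =>
      (Finset.mem_filter.1 H).2 hβV⟩)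
  obtain ⟨h1, h2⟩ := Finset.mem_filter.1 hγ
  exact Finset.mem_filter.2 ⟨h1, fun H => h2 (h γ (mem_finsuppAntidiag_univ.1 h1) H)⟩

lemma mem_of_hilbertCount_le {U V : Set (Fin m →₀ ℕ)} (h : U ⊆ V) {α : Fin m →₀ ℕ}
    (hd : hilbertCount U α.degree ≤ hilbertCount V α.degree) (hV : α ∈ V) : α ∈ U := by
  by_contra hU
  exact absurd hd (not_le.2 (hilbertCount_lt hV hU fun _ _ hβ => h hβ))

lemma hilbertCount_compl (U : Set (Fin m →₀ ℕ)) [DecidablePred (· ∈ U)] (d : ℕ) :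
    hilbertCount Uᶜ d = ((Finset.univ.finsuppAntidiag d).filter (· ∈ U)).card := by
  unfold hilbertCount
  congr 1
  ext α
  simp

lemma GeneratedUpTo.mono {U : Set (Fin m →₀ ℕ)} {s s' : ℕ} (h : GeneratedUpTo U s)
    (hs : s ≤ s') : GeneratedUpTo U s' :=
  fun α hα hd => h α hα (by omega)

/-- If `U ⊆ V` agree in one degree beyond the generators of `V`, they agree from there on. -/
lemma GeneratedUpTo.mem_of_mem {U V : Set (Fin m →₀ ℕ)} (hU : IsStable U) {s j : ℕ}
    (hV : GeneratedUpTo V s) (hj : s ≤ j)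
    (h : ∀ α : Fin m →₀ ℕ, α.degree = j → α ∈ V → α ∈ U) {α : Fin m →₀ ℕ} (hα : j ≤ α.degree)
    (hαV : α ∈ V) : α ∈ U := by
  obtain ⟨k, hk⟩ := Nat.exists_eq_add_of_le hα
  induction k generalizing α with
  | zero => exact h α hk hαV
  | succ k ih =>
    obtain ⟨γ, hγ, i, rfl⟩ := hV α hαV (by omega)
    rw [map_add, degree_single] at hk
    exact hU.add_mem _ (ih (by omega) hγ (by omega)) _

lemma GeneratedUpTo.coneSet {U : Set (Fin m →₀ ℕ)} {s : ℕ} (h : GeneratedUpTo U s) :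
    GeneratedUpTo (coneSet U) s := by
  intro α hα hd
  by_cases h0 : α 0 = 0
  · rw [degree_eq_add_degree_tail, h0, zero_add] at hd
    obtain ⟨γ, hγ, i, hi⟩ := h _ hα hd
    refine ⟨cons 0 γ, by simpa [BorelRemoval.coneSet] using hγ, i.succ, ?_⟩
    rw [← cons_zero_single_eq_single_succ, ← cons_add, ← hi, ← h0, cons_tail]
  · obtain ⟨γ, rfl⟩ := exists_eq_add_single h0
    refine ⟨γ, ?_, 0, rfl⟩
    change tail (γ + single 0 1) ∈ U at hα
    rwa [tail_add, tail_single_zero, add_zero] at hα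

end

section
open Finsupp Filter

variable {m : ℕ}

/-! ### Hilbert functions of saturated stable ideals -/

lemma satSet_fin_zero (U : Set (Fin 0 →₀ ℕ)) : satSet U = Set.univ := by
  refine Set.eq_univ_of_forall fun α => ⟨1, fun β hβ => ?_⟩
  rw [Subsingleton.elim β 0] at hβ
  simp at hβ

/-- Partial sums of a function `e` whose total is `c`, and which beyond the index `s` can only
vanish if it vanishes forever. -/
lemma min_le_sum_of_zero_persists {e : ℕ → ℕ} {s c : ℕ}
    (htot : ∀ᶠ t in atTop, ∑ j ∈ Finset.range t, e j = c)
    (hzero : ∀ j, s ≤ j → e j = 0 → ∀ k, j ≤ k → e k = 0) (d : ℕ) :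
    min c (d - s) ≤ ∑ j ∈ Finset.range d, e j := by
  induction d with
  | zero => simp
  | succ d ih =>
    rw [Finset.sum_range_succ]
    rcases lt_or_ge d s with hd | hd
    · omega
    by_cases h0 : e d = 0
    · obtain ⟨t, ht⟩ := eventually_atTop.1 htot
      have h1 := ht (t + d) (by omega)
      have h2 : ∑ j ∈ Finset.range (t + d), e j = ∑ j ∈ Finset.range d, e j := by
        rw [add_comm t d, Finset.sum_range_add]
        simp [hzero d hd h0]
      omega
    · omega

/-- Macaulay's bound and Gotzmann's regularity theorem for saturated stable ideals. Let `l` be the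
Gotzmann decomposition of the Hilbert polynomial. The Hilbert function is bounded below by
`gotzmannFunction l`, with equality in the degrees `d ≥ l.length - 1`, and the generators have
degree at most `l.length`. -/
theorem hilbertCount_bounds {m : ℕ} {U : Set (Fin m →₀ ℕ)} {l : List ℕ}
    (hU : IsStable U) (hsat : satSet U ⊆ U) (hl : l.Pairwise (· ≥ ·))
    (h : ∀ᶠ t in atTop, hilbertCount U t = gotzmannFunction l t) :
    (∀ d, gotzmannFunction l d ≤ hilbertCount U d) ∧
      (∀ d, l.length ≤ d + 1 → hilbertCount U d = gotzmannFunction l d) ∧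
      GeneratedUpTo U l.length := by
  induction m generalizing l with
  | zero =>
    obtain rfl : U = Set.univ := by
      rw [satSet_fin_zero] at hsat
      exact Set.univ_subset_iff.1 hsat
    have h0 : ∀ d, hilbertCount (Set.univ : Set (Fin 0 →₀ ℕ)) d = 0 := fun d => by
      simp [hilbertCount]
    obtain rfl : l = [] := eq_nil_of_eventually_gotzmannFunction_eq_zero
      (h.mono fun t ht => by rw [← ht, h0])
    refine ⟨by simp, fun d _ => by simp [h0], fun α _ hα => ?_⟩
    rw [Subsingleton.elim α 0] at hα
    simp at hα
  | succ m ih =>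
    obtain ⟨U', hU', rfl⟩ : ∃ U', IsStable U' ∧ U = coneSet U' :=
      ⟨sectionSet U, hU.sectionSet, (coneSet_sectionSet hU hsat).symm⟩
    have hlen := length_lowerList_le l
    -- the saturation `V` of the hyperplane section has the first difference as Hilbert function
    have hdiff : ∀ᶠ t in atTop, hilbertCount U' t = gotzmannFunction (lowerList l) t := by
      obtain ⟨t₀, ht₀⟩ := eventually_atTop.1 h
      refine eventually_atTop.2 ⟨t₀ + l.length + 1, fun t ht => ?_⟩
      obtain ⟨t, rfl⟩ : ∃ s, t = s + 1 := ⟨t - 1, by omega⟩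
      have e1 := gotzmannFunction_succ_of_length_le hl (d := t) (by omega)
      have e2 := ht₀ t (by omega)
      have e3 := ht₀ (t + 1) (by omega)
      rw [hilbertCount_coneSet] at e2 e3
      rw [Finset.sum_range_succ] at e3
      omega
    have hV : ∀ᶠ t in atTop, hilbertCount (satSet U') t = gotzmannFunction (lowerList l) t := by
      filter_upwards [hdiff, eventually_mem_of_mem_satSet hU'] with t ht hmem
      rw [← ht]
      exact hilbertCount_congr fun α hα => ⟨hmem α hα, fun h => subset_satSet hU' h⟩
    obtain ⟨hbound, hreg, hgen⟩ := ih hU'.satSet (satSet_satSet_subset hU')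
      (pairwise_lowerList hl) hV
    have hle : ∀ d, gotzmannFunction (lowerList l) d ≤ hilbertCount U' d := fun d =>
      (hbound d).trans (hilbertCount_anti (subset_satSet hU') d)
    set e : ℕ → ℕ := fun d => hilbertCount U' d - gotzmannFunction (lowerList l) d with he
    have hsum : ∀ d, ∑ j ∈ Finset.range d, hilbertCount U' j =
        ∑ j ∈ Finset.range d, gotzmannFunction (lowerList l) j + ∑ j ∈ Finset.range d, e j := by
      intro d
      rw [← Finset.sum_add_distrib]
      refine Finset.sum_congr rfl fun j _ => ?_
      have := hle j
      simp only [he]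
      omega
    -- once the excess vanishes, `U'` and `V` agree, as `V` has no generators of larger degree
    have hagree : ∀ j, (lowerList l).length ≤ j → e j = 0 →
        ∀ α : Fin m →₀ ℕ, j ≤ α.degree → α ∈ satSet U' → α ∈ U' := by
      intro j hj hej α hα hαV
      refine hgen.mem_of_mem hU' hj (fun β hβ hβV => ?_) hα hαV
      refine mem_of_hilbertCount_le (subset_satSet hU') ?_ hβV
      rw [hβ, hreg j (by omega)]
      exact Nat.le_of_sub_eq_zero hej
    have hzero : ∀ j, (lowerList l).length ≤ j → e j = 0 → ∀ k, j ≤ k → e k = 0 := by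
      intro j hj hej k hk
      have : hilbertCount U' k = hilbertCount (satSet U') k := hilbertCount_congr fun α hα =>
        ⟨fun h => subset_satSet hU' h, hagree j hj hej α (by omega)⟩
      simp only [he]
      rw [this, hreg k (by omega), Nat.sub_self]
    have htot : ∀ᶠ t in atTop, ∑ j ∈ Finset.range t, e j = l.length - (lowerList l).length := by
      obtain ⟨t₀, ht₀⟩ := eventually_atTop.1 h
      refine eventually_atTop.2 ⟨t₀ + l.length + 1, fun t ht => ?_⟩
      obtain ⟨t, rfl⟩ : ∃ s, t = s + 1 := ⟨t - 1, by omega⟩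
      have e1 := ht₀ t (by omega)
      have e2 := gotzmannFunction_eq_sum_lowerList hl t
      have e3 := hsum (t + 1)
      rw [hilbertCount_coneSet] at e1
      omega
    have hpart := min_le_sum_of_zero_persists htot hzero
    have hmono : ∀ d, ∑ j ∈ Finset.range d, e j ≤ l.length - (lowerList l).length := by
      intro d
      obtain ⟨t, ht⟩ := eventually_atTop.1 htot
      rw [← ht (t + d) (by omega)]
      exact Finset.sum_le_sum_of_subset (Finset.range_mono (by omega))
    have hlow : ∀ d, gotzmannFunction l d ≤ hilbertCount (coneSet U') d := by
      intro d
      rw [hilbertCount_coneSet, gotzmannFunction_eq_sum_lowerList hl, hsum]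
      have := hpart (d + 1)
      omega
    refine ⟨hlow, fun d hd => ?_, GeneratedUpTo.coneSet ?_⟩
    · rw [hilbertCount_coneSet, gotzmannFunction_eq_sum_lowerList hl, hsum]
      have h1 := hpart (d + 1)
      have h2 := hmono (d + 1)
      omega
    · -- the excess is used up in degrees below `l.length`
      have hezero : e l.length = 0 := by
        have h1 := hpart l.length
        have h2 := hmono (l.length + 1)
        rw [Finset.sum_range_succ] at h2
        omega
      intro α hα hd
      obtain ⟨γ, hγ, i, rfl⟩ := hgen α (subset_satSet hU' hα) (by omega)
      rw [map_add, degree_single] at hd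
      exact ⟨γ, hagree l.length hlen hezero γ (by omega) hγ, i, rfl⟩

end

section
open Finsupp Filter

variable {m : ℕ}

/-! ### Saturated lexicographic ideals -/

/-- The complement of the saturated lexicographic ideal with Gotzmann decomposition
`b_0 ≥ b_1 ≥ …`. Writing a monomial as the decreasing sequence of its variables, continued by the
smallest variable, these are the monomials whose sequence is lexicographically smaller than
`x_{b_0 + 1}, x_{b_1 + 1}, …`. -/
def lexTail : List ℕ → Set (Fin m →₀ ℕ)
  | [] => ∅
  | b :: l => {α | (∀ i, b < i.val → α i = 0) ∨
      ∃ i : Fin m, i.val = b + 1 ∧ ∃ γ ∈ lexTail l, α = γ + single i 1}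

lemma apply_eq_zero_of_mem_lexTail {l : List ℕ} {b : ℕ} (hb : ∀ x ∈ l, x ≤ b)
    {α : Fin m →₀ ℕ} (hα : α ∈ lexTail l) {i : Fin m} (hi : b + 1 < i.val) : α i = 0 := by
  induction l generalizing α with
  | nil => exact absurd hα (Set.notMem_empty _)
  | cons c l ih =>
    have hc := hb c (by simp)
    rcases hα with hα | ⟨j, hj, γ, hγ, rfl⟩
    · exact hα i (by omega)
    · have hne : i ≠ j := fun h => by rw [h] at hi; omega
      simp [ih (fun x hx => hb x (by simp [hx])) hγ, hne]

lemma mem_lexTail_of_lexGT {n : ℕ} {l : List ℕ} (hl : l.Pairwise (· ≥ ·)) {α β : Fin n →₀ ℕ}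
    (hβ : β ∈ lexTail l) (h : LexGT β α) : α ∈ lexTail l := by
  induction l generalizing α β with
  | nil => exact absurd hβ (Set.notMem_empty _)
  | cons b l ih =>
    rw [List.pairwise_cons] at hl
    obtain ⟨i, hi, hgt⟩ := h
    rcases hβ with hβ | ⟨j, hj, γ, hγ, rfl⟩
    · refine Or.inl fun k hk => ?_
      have hib : i.val ≤ b := by
        by_contra H
        have := hβ i (by omega)
        omega
      rw [← hgt k (Fin.lt_def.2 (by omega)), hβ k hk]
    · have hγ0 : ∀ k : Fin n, b + 1 < k.val → γ k = 0 := fun k hk =>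
        apply_eq_zero_of_mem_lexTail hl.1 hγ hk
      have hij : i ≤ j := by
        by_contra H
        have H' := Fin.lt_def.1 (not_le.1 H)
        have h1 := hγ0 i (by omega)
        rw [Finsupp.add_apply, h1, single_eq_of_ne (by rintro rfl; omega)] at hi
        omega
      have hα0 : ∀ k : Fin n, b + 1 < k.val → α k = 0 := fun k hk => by
        rw [← hgt k (Fin.lt_def.2 (by have := Fin.le_def.1 hij; omega)), Finsupp.add_apply,
          hγ0 k hk, single_eq_of_ne (by rintro rfl; omega), add_zero]
      by_cases hj0 : α j = 0
      · refine Or.inl fun k hk => ?_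
        rcases Nat.lt_or_ge (b + 1) k.val with hk' | hk'
        · exact hα0 k hk'
        · rwa [show k = j from Fin.ext (by omega)]
      · obtain ⟨δ, rfl⟩ := exists_eq_add_single hj0
        refine Or.inr ⟨j, hj, δ, ih hl.2 hγ ⟨i, ?_, fun k hk => ?_⟩, rfl⟩
        · simpa using hi
        · simpa using hgt k hk

lemma add_single_zero_mem_lexTail {l : List ℕ} {α : Fin (m + 1) →₀ ℕ} {k : ℕ} :
    α + single 0 k ∈ lexTail l ↔ α ∈ lexTail l := by
  induction l generalizing α with
  | nil => exact Iff.rfl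
  | cons b l ih =>
    refine or_congr (forall₂_congr fun i hi => ?_)
      (exists_congr fun i => and_congr_right fun hi => ⟨?_, ?_⟩)
    · rw [Finsupp.add_apply, single_eq_of_ne (by rintro rfl; simp at hi), add_zero]
    · rintro ⟨γ, hγ, h⟩
      have hi0 : i ≠ 0 := by rintro rfl; simp at hi
      have hne : α i ≠ 0 := by
        have := DFunLike.congr_fun h i
        rw [Finsupp.add_apply, Finsupp.add_apply, single_eq_of_ne hi0, single_eq_same] at this
        omega
      obtain ⟨δ, rfl⟩ := exists_eq_add_single hne
      rw [add_right_comm, add_left_inj] at h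
      rw [← h, ih] at hγ
      exact ⟨δ, hγ, rfl⟩
    · rintro ⟨γ, hγ, rfl⟩
      exact ⟨γ + single 0 k, ih.2 hγ, add_right_comm _ _ _⟩

lemma hilbertCount_compl_lexTail {l : List ℕ} (hl : ∀ x ∈ l, x + 1 < m) (d : ℕ) :
    hilbertCount (lexTail l : Set (Fin m →₀ ℕ))ᶜ d = gotzmannFunction l d := by
  classical
  induction l generalizing d with
  | nil => simp [hilbertCount, lexTail]
  | cons b l ih =>
    have hb := hl b (by simp)
    have ih := fun d => ih (fun x hx => hl x (by simp [hx])) d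
    rw [hilbertCount_compl]
    simp only [hilbertCount_compl] at ih
    set i : Fin m := ⟨b + 1, hb⟩ with hi
    -- the monomials in the variables of index at most `b`
    have hcard : (((Finset.univ.filter fun k : Fin m => k.val ≤ b)).finsuppAntidiag d).card =
        (d + b).choose b := by
      have hs : (Finset.univ.filter fun k : Fin m => k.val ≤ b).card = b + 1 := by
        have : (Finset.univ.filter fun k : Fin m => k.val ≤ b) = Finset.Iic ⟨b, by omega⟩ := by
          ext k; simp [Fin.le_def]
        rw [this, Fin.card_Iic]
      rw [Finset.card_finsuppAntidiag_nat_eq_choose, hs,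
        show b + 1 + d - 1 = d + b by omega, Nat.choose_symm_add]
    have hmem : ∀ α : Fin m →₀ ℕ,
        α ∈ (Finset.univ.filter fun k : Fin m => k.val ≤ b).finsuppAntidiag d ↔
          α.degree = d ∧ ∀ k, b < k.val → α k = 0 := by
      intro α
      have hsupp : α.support ⊆ (Finset.univ.filter fun k : Fin m => k.val ≤ b) ↔
          ∀ k, b < k.val → α k = 0 := by
        simp only [Finset.subset_iff, mem_support_iff, Finset.mem_filter, Finset.mem_univ,
          true_and]
        exact forall_congr' fun k => by rw [← not_le, not_imp_comm]
      rw [Finset.mem_finsuppAntidiag', hsupp]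
      rfl
    cases d with
    | zero =>
      have h0 : (0 : Fin m →₀ ℕ) ∈ lexTail (b :: l) := Or.inl fun _ _ => rfl
      simp [Finset.filter_singleton, h0]
    | succ d =>
      have hdisj : Disjoint
          ((Finset.univ.filter fun k : Fin m => k.val ≤ b).finsuppAntidiag (d + 1))
          (((Finset.univ.finsuppAntidiag d).filter (· ∈ lexTail l)).map
            (addRightEmbedding (single i 1 : Fin m →₀ ℕ))) := by
        rw [Finset.disjoint_left]
        intro α hα hα'
        rw [hmem] at hα
        obtain ⟨γ, _, rfl⟩ := Finset.mem_map.1 hα'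
        have := hα.2 i (by simp [hi])
        simp at this
      rw [gotzmannFunction_cons_succ, ← hcard, ← ih d,
        ← Finset.card_map (s := (Finset.univ.finsuppAntidiag d).filter (· ∈ lexTail l))
          (addRightEmbedding (single i 1 : Fin m →₀ ℕ)),
        ← Finset.card_union_of_disjoint hdisj]
      congr 1
      ext α
      rw [Finset.mem_filter, mem_finsuppAntidiag_univ, Finset.mem_union, hmem, Finset.mem_map]
      simp only [Finset.mem_filter, mem_finsuppAntidiag_univ, addRightEmbedding_apply]
      constructor
      · rintro ⟨hd, hα | ⟨j, hj, γ, hγ, rfl⟩⟩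
        · exact Or.inl ⟨hd, hα⟩
        · rw [map_add, degree_single] at hd
          exact Or.inr ⟨γ, ⟨by omega, hγ⟩, by rw [show j = i from Fin.ext hj]⟩
      · rintro (⟨hd, hα⟩ | ⟨γ, ⟨hd, hγ⟩, rfl⟩)
        · exact ⟨hd, Or.inl hα⟩
        · exact ⟨by simp [hd], Or.inr ⟨i, rfl, γ, hγ, rfl⟩⟩

lemma lexGT_or_lexGT {n : ℕ} {α β : Fin n →₀ ℕ} (h : α ≠ β) : LexGT α β ∨ LexGT β α := by
  obtain ⟨i, hi⟩ : ∃ i, α i ≠ β i := by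
    by_contra! H
    exact h (Finsupp.ext H)
  obtain ⟨k, -, hk⟩ := exists_maximal_ge_of_wellFoundedGT (fun i => α i ≠ β i) i hi
  have hgt : ∀ j, k < j → α j = β j := fun j hj => by
    by_contra H
    exact absurd (hk.le_of_ge H hj.le) (not_le.2 hj)
  rcases lt_or_gt_of_ne hk.prop with hlt | hlt
  · exact Or.inr ⟨k, hlt, fun j hj => (hgt j hj).symm⟩
  · exact Or.inl ⟨k, hlt, hgt⟩

/-- A saturated lexicographic ideal has the smallest Hilbert function its Hilbert polynomial
allows: it coincides with the complement of `lexTail` in large degrees, as both are lexicographic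
segments of the same size, and then in all degrees by saturation. -/
theorem hilbertCount_le_of_lex {n : ℕ} {U : Set (Fin n →₀ ℕ)} {l : List ℕ} (hU : IsStable U)
    (hsat : satSet U ⊆ U) (hl : l.Pairwise (· ≥ ·)) (hln : ∀ x ∈ l, x + 1 < n)
    (hlex : ∀ α β : Fin n →₀ ℕ, α.degree = β.degree → LexGT α β → β ∈ U → α ∈ U)
    (h : ∀ᶠ t in atTop, hilbertCount U t = gotzmannFunction l t) (d : ℕ) :
    hilbertCount U d ≤ gotzmannFunction l d := by
  classical
  cases n with
  | zero =>
    rw [satSet_fin_zero, Set.univ_subset_iff] at hsat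
    simp [hilbertCount, hsat]
  | succ n =>
    rw [← hilbertCount_compl_lexTail hln]
    obtain ⟨t₀, ht₀⟩ := eventually_atTop.1 h
    refine hilbertCount_anti (fun α hα => ?_) d
    by_contra hαU
    have hα' : α + single 0 t₀ ∉ U := fun H => hαU (mem_of_add_single_zero_mem hU hsat H)
    have hα'' : α + single 0 t₀ ∉ lexTail l := fun H => hα (add_single_zero_mem_lexTail.1 H)
    generalize hβ : α + single 0 t₀ = β at hα' hα''
    have hdeg : t₀ ≤ β.degree := by rw [← hβ, map_add, degree_single]; omega
    have hcount := ht₀ β.degree hdeg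
    rw [← hilbertCount_compl_lexTail hln] at hcount
    -- every monomial of `lexTail` in the degree of `β` is smaller than `β`, so outside of `U`
    have hsub : ∀ γ : Fin (n + 1) →₀ ℕ, γ.degree = β.degree → γ ∈ lexTail l → γ ∉ U := by
      intro γ hγ hγl hγU
      have hne : γ ≠ β := fun H => hα' (H ▸ hγU)
      rcases lexGT_or_lexGT hne with H | H
      · exact hα'' (mem_lexTail_of_lexGT hl hγl H)
      · exact hα' (hlex β γ hγ.symm H hγU)
    have hlt : hilbertCount (lexTail l : Set (Fin (n + 1) →₀ ℕ))ᶜ β.degree <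
        hilbertCount U β.degree :=
      hilbertCount_lt hα'' hα' fun γ hγ hγU hγl => hsub γ hγ hγl hγU
    omega

end

section
open Finsupp Filter

/-! ### Borel sets and removals -/

variable {n r : ℕ} {B : Finset (Fin (n + 1) →₀ ℕ)}

lemma mem_pos {α : Fin (n + 1) →₀ ℕ} : α ∈ pos n r ↔ α.degree = r := mem_finsuppAntidiag_univ

lemma IsBorelSet.move_mem (hB : IsBorelSet r B) {γ : Fin (n + 1) →₀ ℕ} {i j : Fin (n + 1)}
    (hij : i < j) (h : γ + single i 1 ∈ B) : γ + single j 1 ∈ B := by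
  induction j using Fin.induction with
  | zero => exact absurd hij (Fin.not_lt_zero i)
  | succ j ih =>
    have h' : γ + single j.castSucc 1 ∈ B := by
      rcases (Fin.le_castSucc_iff.2 hij).eq_or_lt with rfl | hlt
      · exact h
      · exact ih hlt
    have := hB.2 _ h' j (by simp)
    rwa [add_tsub_cancel_right] at this

/-- The exponents of the ideal generated by the monomials in `B`. -/
def upSet (B : Finset (Fin (n + 1) →₀ ℕ)) : Set (Fin (n + 1) →₀ ℕ) :=
  {α | ∃ u ∈ B, u ≤ α}

lemma IsBorelSet.isStable_upSet (hB : IsBorelSet r B) : IsStable (upSet B) where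
  add_mem := fun _ ⟨u, hu, hle⟩ _ => ⟨u, hu, hle.trans le_self_add⟩
  move_mem := by
    rintro γ i j hij ⟨u, hu, hle⟩
    by_cases hγ : u ≤ γ
    · exact ⟨u, hu, hγ.trans le_self_add⟩
    have hui : u i ≠ 0 := by
      intro h0
      refine hγ fun k => ?_
      have := hle k
      rw [Finsupp.add_apply] at this
      by_cases hk : k = i
      · rw [hk, h0]; exact Nat.zero_le _
      · rwa [single_eq_of_ne hk, add_zero] at this
    obtain ⟨v, rfl⟩ := exists_eq_add_single hui
    exact ⟨_, hB.move_mem hij hu, by gcongr; exact le_of_add_le_add_right hle⟩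

lemma IsBorelSet.mem_of_mem_satSet (hB : IsBorelSet r B) {α : Fin (n + 1) →₀ ℕ}
    (hα : α.degree = r) (h : α ∈ satSet (upSet B)) : α ∈ B := by
  obtain ⟨k, u, hu, hle⟩ := (mem_satSet_iff hB.isStable_upSet).1 h
  obtain ⟨v, hv⟩ := exists_add_of_le hle
  clear h hle
  -- a factor `x_0` of the cofactor `v` is cancelled; otherwise a factor `x_0` of `u` is traded
  -- for another variable of `v`
  induction k generalizing u v with
  | zero =>
    have hdeg := congrArg degree hv
    rw [single_zero, add_zero, map_add, hα, mem_pos.1 (hB.1 hu)] at hdeg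
    obtain rfl : v = 0 := (degree_eq_zero_iff v).1 (by omega)
    rw [single_zero, add_zero, add_zero] at hv
    rwa [hv]
  | succ k ih =>
    have hdeg := congrArg degree hv
    rw [map_add, map_add, hα, degree_single, mem_pos.1 (hB.1 hu)] at hdeg
    obtain ⟨j, hj⟩ := exists_apply_ne_zero (α := v) (by omega)
    by_cases hv0 : v 0 = 0
    · have hu0 : u 0 ≠ 0 := by
        have := DFunLike.congr_fun hv 0
        rw [Finsupp.add_apply, Finsupp.add_apply, hv0, single_eq_same] at this
        omega
      have hj0 : 0 < j := Fin.pos_iff_ne_zero.2 fun h => hj (h ▸ hv0)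
      obtain ⟨w, rfl⟩ := exists_eq_add_single hj
      obtain ⟨u, rfl⟩ := exists_eq_add_single hu0
      refine ih _ (hB.move_mem hj0 hu) w ?_
      rw [single_add, ← add_assoc, add_right_comm u, ← add_assoc u] at hv
      rw [add_right_cancel hv]
      abel
    · obtain ⟨w, rfl⟩ := exists_eq_add_single hv0
      refine ih u hu w ?_
      rw [single_add, ← add_assoc, ← add_assoc] at hv
      exact add_right_cancel hv

lemma IsBorelSet.hilbertCount_satSet (hB : IsBorelSet r B) :
    hilbertCount (satSet (upSet B)) r = (pos n r \ B).card := by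
  classical
  unfold hilbertCount
  congr 1
  ext α
  rw [Finset.mem_filter, Finset.mem_sdiff]
  refine and_congr_right fun hα => not_congr ⟨hB.mem_of_mem_satSet (mem_pos.1 hα), fun h => ?_⟩
  exact subset_satSet hB.isStable_upSet ⟨α, h, le_rfl⟩

/-- From a Borel set one can remove any number of its multiples of the smallest variable: the
remaining ones always include one that is not reached by an elementary move from another. -/
lemma IsBorelSet.exists_removal (hB : IsBorelSet r B) {k : ℕ}
    (hk : k ≤ (B.filter fun α => α 0 ≠ 0).card) :
    ∃ B' ⊆ B, IsBorelSet r B' ∧ (B \ B').card = k ∧ ∀ α ∈ B, α ∉ B' → α 0 ≠ 0 := by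
  induction k with
  | zero => exact ⟨B, subset_rfl, hB, by simp, fun α h h' => absurd h h'⟩
  | succ k ih =>
    obtain ⟨B', hsub, hB', hcard, hzero⟩ := ih (by omega)
    have hne : (B'.filter fun α => α 0 ≠ 0).Nonempty := by
      by_contra H
      rw [Finset.not_nonempty_iff_eq_empty] at H
      have : (B.filter fun α => α 0 ≠ 0) ⊆ B \ B' := fun α hα => by
        obtain ⟨h1, h2⟩ := Finset.mem_filter.1 hα
        refine Finset.mem_sdiff.2 ⟨h1, fun h3 => ?_⟩
        exact Finset.notMem_empty α (H ▸ Finset.mem_filter.2 ⟨h3, h2⟩)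
      have := Finset.card_le_card this
      omega
    -- elementary moves increase the weight `∑ i * α i`
    obtain ⟨τ, hτ, hmin⟩ := Finset.exists_min_image _
      (Finsupp.weight (fun i : Fin (n + 1) => i.val)) hne
    obtain ⟨hτB, hτ0⟩ := Finset.mem_filter.1 hτ
    refine ⟨B'.erase τ, (Finset.erase_subset _ _).trans hsub,
      ⟨(Finset.erase_subset _ _).trans hB'.1, fun α hα i hi => ?_⟩, ?_, fun α hα hα' => ?_⟩
    · refine Finset.mem_erase.2 ⟨fun heq => ?_, hB'.2 α (Finset.mem_of_mem_erase hα) i hi⟩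
      obtain ⟨γ, rfl⟩ := exists_eq_add_single hi
      rw [add_tsub_cancel_right] at heq
      have hγ0 : γ 0 ≠ 0 := by
        rw [← heq, Finsupp.add_apply, single_eq_of_ne (Fin.succ_ne_zero i).symm, add_zero] at hτ0
        exact hτ0
      have := hmin _ (Finset.mem_filter.2 ⟨Finset.mem_of_mem_erase hα, by simp [hγ0]⟩)
      rw [← heq] at this
      simp [Finsupp.weight_single] at this
    · rw [Finset.sdiff_erase (hsub hτB), Finset.card_insert_of_notMem (by simp [hτB]), hcard]
    · by_cases hατ : α = τ
      · exact hατ ▸ hτ0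
      · exact hzero α hα fun h => hα' (Finset.mem_erase.2 ⟨hατ, h⟩)

/-- Removing multiples of the smallest variable `x_0` from the degree `r` piece of a saturated
stable ideal generated in degrees at most `r` raises the Hilbert polynomial by the number of
monomials removed: in degree `r + s` the ideal loses exactly the products of these monomials with
`x_0 ^ s`. -/
theorem IsBorelSet.hilbertCount_removal {W : Set (Fin (n + 1) →₀ ℕ)} (hW : IsStable W)
    (hsat : satSet W ⊆ W) (hgen : GeneratedUpTo W r) (hB : IsBorelSet r B) {A : Finset _}
    (hA : ∀ α, α ∈ A ↔ α.degree = r ∧ α ∈ W) (hBA : B ⊆ A)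
    (hzero : ∀ α ∈ A, α ∉ B → α 0 ≠ 0) (s : ℕ) :
    hilbertCount (satSet (upSet B)) (r + s) = hilbertCount W (r + s) + (A \ B).card := by
  classical
  have hVW : satSet (upSet B) ⊆ W := by
    intro α hα
    obtain ⟨k, u, hu, hle⟩ := (mem_satSet_iff hB.isStable_upSet).1 hα
    exact mem_of_add_single_zero_mem hW hsat (hW.mem_of_le hle ((hA u).1 (hBA hu)).2)
  have hmem : ∀ s, ∀ α ∈ W, α.degree = r + s → (∀ τ ∈ A \ B, τ + single 0 s ≠ α) →
      α ∈ upSet B := by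
    intro s
    induction s with
    | zero =>
      intro α hα hd hτ
      refine ⟨α, ?_, le_rfl⟩
      by_contra hαB
      exact hτ α (Finset.mem_sdiff.2 ⟨(hA α).2 ⟨hd, hα⟩, hαB⟩) (by simp)
    | succ s ih =>
      intro α hα hd hτ
      by_cases h0 : α 0 = 0
      · obtain ⟨γ, hγ, i, rfl⟩ := hgen α hα (by omega)
        rw [map_add, degree_single] at hd
        refine hB.isStable_upSet.add_mem _ (ih γ hγ (by omega) fun τ hτAB heq => ?_) _
        obtain ⟨h1, h2⟩ := Finset.mem_sdiff.1 hτAB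
        have h3 := hzero τ h1 h2
        rw [← heq, Finsupp.add_apply, Finsupp.add_apply] at h0
        omega
      · obtain ⟨γ, rfl⟩ := exists_eq_add_single h0
        rw [map_add, degree_single] at hd
        refine hB.isStable_upSet.add_mem _ (ih γ (mem_of_add_single_zero_mem hW hsat hα)
          (by omega) fun τ hτAB heq => hτ τ hτAB ?_) _
        rw [← heq, single_add, add_assoc]
  have hdisj : Disjoint ((Finset.univ.finsuppAntidiag (r + s)).filter (· ∉ W))
      ((A \ B).map (addRightEmbedding (single 0 s))) := by
    rw [Finset.disjoint_left]
    intro α hα hα'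
    obtain ⟨τ, hτ, rfl⟩ := Finset.mem_map.1 hα'
    exact (Finset.mem_filter.1 hα).2
      (hW.add_mem _ ((hA τ).1 (Finset.mem_sdiff.1 hτ).1).2 _)
  rw [← Finset.card_map (addRightEmbedding (single 0 s))]
  unfold hilbertCount
  rw [← Finset.card_union_of_disjoint hdisj]
  congr 1
  ext α
  simp only [Finset.mem_filter, Finset.mem_union, mem_finsuppAntidiag_univ, Finset.mem_map,
    addRightEmbedding_apply]
  constructor
  · rintro ⟨hd, hα⟩
    by_contra! H
    exact hα (subset_satSet hB.isStable_upSet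
      (hmem s α (by_contra fun h => h (H.1 hd)) hd fun τ hτ => H.2 τ hτ))
  · rintro (⟨hd, hα⟩ | ⟨τ, hτ, rfl⟩)
    · exact ⟨hd, fun h => hα (hVW h)⟩
    · obtain ⟨hτA, hτB⟩ := Finset.mem_sdiff.1 hτ
      have hτr := ((hA τ).1 hτA).1
      refine ⟨by rw [map_add, degree_single, hτr], fun h => hτB ?_⟩
      exact hB.mem_of_mem_satSet hτr (mem_of_add_single_zero_mem hB.isStable_upSet.satSet
        (satSet_satSet_subset hB.isStable_upSet) h)

end

section
open MvPolynomial

/-! ### Monomial ideals -/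

section General

variable {σ K : Type*} [Field K]

/-- The exponents of the monomials in an ideal. -/
def exponentSet (I : Ideal (MvPolynomial σ K)) : Set (σ →₀ ℕ) := {α | monomial α (1 : K) ∈ I}

/-- An ideal is monomial if it contains with a polynomial all of its monomials. -/
def IsMonomialIdeal (I : Ideal (MvPolynomial σ K)) : Prop :=
  ∀ f ∈ I, ∀ α ∈ f.support, α ∈ exponentSet I

lemma monomial_mem_of_mem_exponentSet {I : Ideal (MvPolynomial σ K)} {α : σ →₀ ℕ}
    (h : α ∈ exponentSet I) (c : K) : monomial α c ∈ I := by
  rw [← mul_one c, ← C_mul_monomial]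
  exact I.mul_mem_left _ h

lemma mem_exponentSet_of_monomial_mem {I : Ideal (MvPolynomial σ K)} {α : σ →₀ ℕ} {c : K}
    (hc : c ≠ 0) (h : monomial α c ∈ I) : α ∈ exponentSet I := by
  have := I.mul_mem_left (C c⁻¹) h
  rwa [C_mul_monomial, inv_mul_cancel₀ hc] at this

lemma mem_of_support_subset {I : Ideal (MvPolynomial σ K)} {f : MvPolynomial σ K}
    (h : ∀ α ∈ f.support, α ∈ exponentSet I) : f ∈ I := by
  rw [f.as_sum]
  exact I.sum_mem fun α hα => monomial_mem_of_mem_exponentSet (h α hα) _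

lemma add_mem_exponentSet {I : Ideal (MvPolynomial σ K)} {α : σ →₀ ℕ} (h : α ∈ exponentSet I)
    (β : σ →₀ ℕ) : α + β ∈ exponentSet I := by
  have := I.mul_mem_right (monomial β 1) h
  rwa [monomial_mul, one_mul] at this

lemma mem_exponentSet_of_le {I : Ideal (MvPolynomial σ K)} {α β : σ →₀ ℕ} (h : α ≤ β)
    (hα : α ∈ exponentSet I) : β ∈ exponentSet I := by
  obtain ⟨γ, rfl⟩ := exists_add_of_le h
  exact add_mem_exponentSet hα γ

lemma mem_exponentSet_monomialIdeal {A : Set (σ →₀ ℕ)} {α : σ →₀ ℕ} :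
    α ∈ exponentSet (monomialIdeal K A) ↔ ∃ u ∈ A, u ≤ α := by
  classical
  change monomial α (1 : K) ∈ Ideal.span _ ↔ _
  rw [mem_ideal_span_monomial_image, support_monomial, if_neg one_ne_zero]
  simp

lemma isMonomialIdeal_monomialIdeal (A : Set (σ →₀ ℕ)) : IsMonomialIdeal (monomialIdeal K A) :=
  fun _ hf α hα => mem_exponentSet_monomialIdeal.2 (mem_ideal_span_monomial_image.1 hf α hα)

lemma IsMonomialIdeal.eq_monomialIdeal {I : Ideal (MvPolynomial σ K)} (hI : IsMonomialIdeal I) :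
    I = monomialIdeal K (exponentSet I) := by
  refine le_antisymm (fun f hf => ?_) (Ideal.span_le.2 ?_)
  · exact mem_ideal_span_monomial_image.2 fun α hα => ⟨α, hI f hf α hα, le_rfl⟩
  · rintro _ ⟨α, hα, rfl⟩
    exact hα

lemma IsMonomialIdeal.add_mem_of_mem_saturation {I : Ideal (MvPolynomial σ K)}
    (hI : IsMonomialIdeal I) {f : MvPolynomial σ K} {k : ℕ}
    (hf : ∀ g ∈ idealOfVars σ K ^ k, f * g ∈ I) {α β : σ →₀ ℕ} (hα : α ∈ f.support)
    (hβ : β.degree = k) : α + β ∈ exponentSet I := by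
  refine hI _ (hf (monomial β 1) ((monomial_mem_pow_idealOfVars_iff k β one_ne_zero).2 hβ.ge)) _ ?_
  rw [mem_support_iff, coeff_mul_monomial, mul_one]
  exact mem_support_iff.1 hα

lemma monomial_mem_saturation {I : Ideal (MvPolynomial σ K)} {α : σ →₀ ℕ} {k : ℕ}
    (h : ∀ β : σ →₀ ℕ, β.degree = k → α + β ∈ exponentSet I) :
    α ∈ exponentSet (saturation I) := by
  refine ⟨k, fun g hg => mem_of_support_subset fun γ hγ => ?_⟩
  rw [mem_support_iff, coeff_monomial_mul', one_mul] at hγ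
  obtain ⟨hle, hne⟩ := ite_ne_right_iff.1 hγ
  have hdeg := (mem_pow_idealOfVars_iff k g).1 hg _ (mem_support_iff.2 hne)
  obtain ⟨β, hβ, hβk⟩ := Finsupp.exists_le_degree_eq _ k hdeg
  refine mem_exponentSet_of_le ?_ (h β hβk)
  calc α + β ≤ α + (γ - α) := by gcongr
    _ = γ := add_tsub_cancel_of_le hle

lemma isMonomialIdeal_saturation {I : Ideal (MvPolynomial σ K)} (hI : IsMonomialIdeal I) :
    IsMonomialIdeal (saturation I) := by
  rintro f ⟨k, hk⟩ α hα
  exact monomial_mem_saturation fun β hβ => hI.add_mem_of_mem_saturation hk hα hβ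

end General

variable {K : Type*} [Field K] {m : ℕ}

lemma exponentSet_saturation {I : Ideal (MvPolynomial (Fin m) K)}
    (hI : IsMonomialIdeal I) : exponentSet (saturation I) = satSet (exponentSet I) := by
  ext α
  constructor
  · rintro ⟨k, hk⟩
    refine ⟨k, fun β hβ => hI.add_mem_of_mem_saturation hk ?_ hβ⟩
    simp
  · rintro ⟨k, hk⟩
    exact monomial_mem_saturation hk

lemma IsMonomialIdeal.satSet_subset {I : Ideal (MvPolynomial (Fin m) K)}
    (hI : IsMonomialIdeal I) (hsat : IsSaturated I) :
    satSet (exponentSet I) ⊆ exponentSet I := by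
  rw [← exponentSet_saturation hI, hsat]

/-- The coefficients of a homogeneous polynomial at the exponents in `s`. -/
def coeffsOn (K : Type*) [Field K] (t : ℕ) (s : Finset (Fin m →₀ ℕ)) :
    homogeneousSubmodule (Fin m) K t →ₗ[K] (s → K) :=
  LinearMap.pi fun a => (lcoeff K a.1).comp (homogeneousSubmodule (Fin m) K t).subtype

lemma coeffsOn_surjective {t : ℕ} {s : Finset (Fin m →₀ ℕ)} (hs : ∀ α ∈ s, α.degree = t) :
    Function.Surjective (coeffsOn K t s) := by
  classical
  intro v
  refine ⟨⟨∑ a : s, monomial a.1 (v a), Submodule.sum_mem _ fun a _ => ?_⟩, ?_⟩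
  · exact isHomogeneous_monomial _ (hs _ a.2)
  · ext a
    simp [coeffsOn, coeff_monomial]

lemma finite_homogeneousSubmodule (t : ℕ) :
    Module.Finite K (homogeneousSubmodule (Fin m) K t) := by
  refine Module.Finite.of_injective (coeffsOn K t (Finset.univ.finsuppAntidiag t)) ?_
  rw [← LinearMap.ker_eq_bot, LinearMap.ker_eq_bot']
  intro f hf
  ext α
  by_cases hα : α.degree = t
  · exact congrFun hf ⟨α, mem_finsuppAntidiag_univ.2 hα⟩
  · exact f.2.coeff_eq_zero hα

/-- The Hilbert function of a monomial ideal counts the monomials outside of it. -/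
lemma IsMonomialIdeal.hilbertFunction_eq {I : Ideal (MvPolynomial (Fin m) K)}
    (hI : IsMonomialIdeal I) (t : ℕ) : hilbertFunction I t = hilbertCount (exponentSet I) t := by
  classical
  set s := (Finset.univ.finsuppAntidiag t).filter (· ∉ exponentSet I) with hs
  have hker : LinearMap.ker (coeffsOn K t s) =
      (Submodule.restrictScalars K I).comap (homogeneousSubmodule (Fin m) K t).subtype := by
    ext f
    rw [LinearMap.mem_ker, Submodule.mem_comap, Submodule.restrictScalars_mem]
    constructor
    · intro hf
      refine mem_of_support_subset fun α hα => ?_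
      by_contra H
      have hd : α.degree = t := by
        by_contra hd
        exact mem_support_iff.1 hα (f.2.coeff_eq_zero hd)
      exact mem_support_iff.1 hα (congrFun hf
        ⟨α, Finset.mem_filter.2 ⟨mem_finsuppAntidiag_univ.2 hd, H⟩⟩)
    · intro hf
      ext a
      by_contra H
      exact (Finset.mem_filter.1 a.2).2 (hI _ hf _ (mem_support_iff.2 H))
  have hsurj : Function.Surjective (coeffsOn K t s) :=
    coeffsOn_surjective fun α hα => mem_finsuppAntidiag_univ.1 (Finset.mem_filter.1 hα).1
  unfold hilbertFunction
  rw [← hker, (LinearMap.quotKerEquivOfSurjective _ hsurj).finrank_eq,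
    Module.finrank_fintype_fun_eq_card, Fintype.card_coe]
  rfl

lemma hilbertFunction_le_choose {n : ℕ} (I : Ideal (MvPolynomial (Fin (n + 1)) K)) (t : ℕ) :
    hilbertFunction I t ≤ (t + n).choose n := by
  have hbot : hilbertFunction (⊥ : Ideal (MvPolynomial (Fin (n + 1)) K)) t =
      (t + n).choose n := by
    have hmon : IsMonomialIdeal (⊥ : Ideal (MvPolynomial (Fin (n + 1)) K)) := by
      intro f hf α hα
      rw [(Ideal.mem_bot).1 hf] at hα
      simp at hα
    rw [hmon.hilbertFunction_eq, ← hilbertCount_empty]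
    congr 1
    ext α
    simp [exponentSet]
  have := finite_homogeneousSubmodule (K := K) (m := n + 1) t
  rw [← hbot]
  unfold hilbertFunction
  refine LinearMap.finrank_le_finrank_of_surjective
    (f := Submodule.factor (Submodule.comap_mono fun f hf => ?_))
    (Submodule.factor_surjective _)
  rw [Submodule.restrictScalars_mem, Ideal.mem_bot] at hf
  rw [hf]
  exact zero_mem _

lemma IsMonomialIdeal.exponentSet_extendIdeal {J : Ideal (MvPolynomial (Fin m) K)}
    (hJ : IsMonomialIdeal J) : exponentSet (extendIdeal J) = coneSet (exponentSet J) := by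
  have hcons : ∀ β : Fin m →₀ ℕ, Finsupp.mapDomain Fin.succ β = Finsupp.cons 0 β := by
    intro β
    ext i
    refine Fin.cases ?_ (fun i => ?_) i
    · rw [Finsupp.mapDomain_of_notMem_range _ _ (by simp), Finsupp.cons_zero]
    · rw [Finsupp.mapDomain_apply (Fin.succ_injective m), Finsupp.cons_succ]
  have h : extendIdeal J = monomialIdeal K (Finsupp.cons 0 '' exponentSet J) := by
    unfold extendIdeal
    conv_lhs => rw [hJ.eq_monomialIdeal]
    rw [monomialIdeal, Ideal.map_span, monomialIdeal, Set.image_image, Set.image_image]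
    congr 1
    refine Set.image_congr fun β _ => ?_
    rw [rename_monomial, hcons]
  ext α
  rw [h, mem_exponentSet_monomialIdeal]
  constructor
  · rintro ⟨_, ⟨β, hβ, rfl⟩, hle⟩
    refine mem_exponentSet_of_le (fun i => ?_) hβ
    simpa [Finsupp.tail_apply] using hle i.succ
  · intro hα
    refine ⟨_, ⟨_, hα, rfl⟩, fun i => ?_⟩
    refine Fin.cases ?_ (fun i => ?_) i <;> simp [Finsupp.tail_apply]

/-! ### Borel-fixed ideals and lexicographic ideals are stable -/

lemma coeff_linearSubst_diagonal (c : Fin m → K) (f : MvPolynomial (Fin m) K) (α : Fin m →₀ ℕ) :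
    coeff α (linearSubst (Matrix.diagonal c) f) = (α.prod fun i k => c i ^ k) * coeff α f := by
  classical
  have h : ∀ i, ∑ j, C (Matrix.diagonal c i j) * X j = C (c i) * (X i : MvPolynomial (Fin m) K) :=
    fun i => by
      rw [Finset.sum_eq_single i (fun j _ hj => by simp [Matrix.diagonal_apply_ne' _ hj])
        (by simp), Matrix.diagonal_apply_eq]
  induction f using MvPolynomial.induction_on' with
  | monomial β a =>
    have : linearSubst (Matrix.diagonal c) (monomial β a) =
        monomial β ((β.prod fun i k => c i ^ k) * a) := by
      rw [linearSubst, aeval_monomial]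
      simp only [h, mul_pow]
      rw [Finsupp.prod_mul, algebraMap_eq, mul_comm _ a, ← C_mul_monomial (s := β), ← mul_one
        (β.prod fun i k => c i ^ k), ← C_mul_monomial, monomial_eq (s := β)]
      simp [Finsupp.prod, map_prod]
    rw [this, coeff_monomial, coeff_monomial]
    split_ifs with hβ
    · rw [hβ]
    · simp
  | add p q hp hq => rw [map_add, coeff_add, hp, hq, coeff_add, mul_add]

lemma IsBorelFixed.linearSubst_mem {I : Ideal (MvPolynomial (Fin m) K)} (hI : IsBorelFixed I)
    {M : Matrix (Fin m) (Fin m) K} (hdet : M.det ≠ 0) (hM : M.BlockTriangular id)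
    {f : MvPolynomial (Fin m) K} (hf : f ∈ I) : linearSubst M f ∈ I := by
  have h := hI.2 (Matrix.GeneralLinearGroup.mkOfDetNeZero M hdet) hM
  have h' := Ideal.mem_map_of_mem (linearSubst M) hf
  exact h ▸ h'

/-- Two monomials of a polynomial are separated by a torus element that doubles one variable;
subtracting a multiple of the original polynomial removes one of them. -/
lemma IsBorelFixed.isMonomialIdeal [CharZero K] {I : Ideal (MvPolynomial (Fin m) K)}
    (hI : IsBorelFixed I) : IsMonomialIdeal I := by
  classical
  suffices H : ∀ k, ∀ f ∈ I, f.support.card = k → ∀ α ∈ f.support, α ∈ exponentSet I from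
    fun f hf α hα => H _ f hf rfl α hα
  intro k
  induction k using Nat.strong_induction_on with
  | _ k ih =>
  intro f hf hk α hα
  by_cases hsingle : ∃ β ∈ f.support, β ≠ α
  · obtain ⟨β, hβ, hne⟩ := hsingle
    obtain ⟨i, hi⟩ : ∃ i, β i ≠ α i := by
      by_contra! H
      exact hne (Finsupp.ext H)
    set c : Fin m → K := Function.update 1 i 2 with hc
    have hprod : ∀ γ : Fin m →₀ ℕ, (γ.prod fun i k => c i ^ k) = 2 ^ γ i := by
      intro γ
      rw [Finsupp.prod_fintype _ _ (by simp), Finset.prod_eq_single i]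
      · simp [hc]
      · intro j _ hj
        simp [hc, Function.update_of_ne hj]
      · simp
    have hdet : (Matrix.diagonal c).det ≠ 0 := by
      rw [Matrix.det_diagonal, Finset.prod_ne_zero_iff]
      intro j _
      by_cases hj : j = i
      · rw [hj]; simp [hc]
      · simp [hc, Function.update_of_ne hj]
    have hmem := hI.linearSubst_mem hdet (Matrix.blockTriangular_diagonal _) hf
    set g := linearSubst (Matrix.diagonal c) f - C (2 ^ β i) * f with hg
    have hgI : g ∈ I := I.sub_mem hmem (I.mul_mem_left _ hf)
    have hcoeff : ∀ γ, coeff γ g = (2 ^ γ i - 2 ^ β i) * coeff γ f := fun γ => by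
      rw [hg, coeff_sub, coeff_linearSubst_diagonal, hprod, coeff_C_mul, sub_mul]
    have hsub : g.support ⊂ f.support := by
      refine (Finset.ssubset_iff_of_subset fun γ hγ => ?_).2 ⟨β, hβ, ?_⟩
      · rw [mem_support_iff, hcoeff] at hγ
        exact mem_support_iff.2 (right_ne_zero_of_mul hγ)
      · rw [mem_support_iff, hcoeff, sub_self, zero_mul]
        exact fun h => h rfl
    refine ih _ (hk ▸ Finset.card_lt_card hsub) g hgI rfl α ?_
    rw [mem_support_iff, hcoeff]
    refine mul_ne_zero (sub_ne_zero.2 fun h => hi ?_) (mem_support_iff.1 hα)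
    have h' : (2 : ℕ) ^ α i = 2 ^ β i := by exact_mod_cast h
    exact (Nat.pow_right_injective le_rfl h').symm
  · push Not at hsingle
    have hf' : f = monomial α (coeff α f) := by
      conv_lhs => rw [f.as_sum, Finset.sum_eq_single_of_mem α hα
        fun β hβ hne => absurd (hsingle β hβ) hne]
    exact mem_exponentSet_of_monomial_mem (mem_support_iff.1 hα) (hf' ▸ hf)

lemma coeff_add_pow_succ {i j : Fin m} (hij : i ≠ j) (k : ℕ) :
    coeff (Finsupp.single i k + Finsupp.single j 1)
      ((X i + X j : MvPolynomial (Fin m) K) ^ (k + 1)) = (k + 1 : K) := by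
  classical
  rw [add_pow, coeff_sum, Finset.sum_eq_single k]
  · rw [X_pow_eq_monomial, X_pow_eq_monomial, monomial_mul, ← C_eq_coe_nat, mul_comm, coeff_C_mul,
      show k + 1 - k = 1 by omega, coeff_monomial, if_pos rfl, Nat.choose_succ_self_right]
    simp
  · intro l _ hl
    rw [X_pow_eq_monomial, X_pow_eq_monomial, monomial_mul, ← C_eq_coe_nat, mul_comm, coeff_C_mul,
      coeff_monomial, if_neg, mul_zero]
    intro h
    have := DFunLike.congr_fun h i
    simp [Finsupp.single_eq_of_ne hij] at this
    exact hl this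
  · simp

/-- The substitution `x_i ↦ x_i + x_j` produces `x_j / x_i` times a monomial with the exponent of
`x_i` as its coefficient, which does not vanish in characteristic zero. -/
lemma IsBorelFixed.isStable [CharZero K] {I : Ideal (MvPolynomial (Fin m) K)}
    (hI : IsBorelFixed I) : IsStable (exponentSet I) where
  add_mem _ hα β := add_mem_exponentSet hα β
  move_mem := by
    classical
    intro γ i j hij h
    have hne : i ≠ j := hij.ne
    obtain ⟨δ, k, hδ, rfl⟩ : ∃ (δ : Fin m →₀ ℕ) (k : ℕ), δ i = 0 ∧ γ = δ + Finsupp.single i k :=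
      ⟨γ.erase i, γ i, by simp, by rw [add_comm, Finsupp.single_add_erase]⟩
    have hmem := hI.linearSubst_mem (M := Matrix.transvection i j 1)
      (by rw [Matrix.det_transvection_of_ne i j hne]; exact one_ne_zero)
      (fun a b (hab : b < a) => by
        rw [Matrix.transvection, Matrix.add_apply, Matrix.one_apply_ne hab.ne',
          Matrix.single_apply_of_ne, add_zero]
        rintro ⟨rfl, rfl⟩
        exact absurd hab hij.not_gt) h
    have hX : ∀ a, ∑ b, C (Matrix.transvection i j (1 : K) a b) * X b =
        (X a + if a = i then X j else 0 : MvPolynomial (Fin m) K) := by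
      intro a
      simp only [Matrix.transvection, Matrix.add_apply, map_add, add_mul, Finset.sum_add_distrib]
      congr 1
      · rw [Finset.sum_eq_single a (fun b _ hb => by simp [Matrix.one_apply_ne' hb]) (by simp)]
        simp
      · rw [Finset.sum_eq_single j (fun b _ hb => by simp [hb.symm])
          (by simp)]
        by_cases ha : a = i
        · simp [ha]
        · simp [ha, Ne.symm ha]
    have himage : linearSubst (Matrix.transvection i j (1 : K))
        (monomial (δ + Finsupp.single i k + Finsupp.single i 1) 1) =
        monomial δ 1 * (X i + X j) ^ (k + 1) := by
      have hδ' : linearSubst (Matrix.transvection i j (1 : K)) (monomial δ 1) =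
          monomial δ 1 := by
        rw [linearSubst, aeval_monomial, monomial_eq, map_one, C_1]
        congr 1
        refine Finsupp.prod_congr fun a ha => ?_
        rw [hX, if_neg (fun h : a = i => Finsupp.mem_support_iff.1 ha (h ▸ hδ)), add_zero]
      rw [add_assoc, ← Finsupp.single_add, monomial_add_single, map_mul, hδ', map_pow]
      congr 2
      rw [linearSubst, aeval_X, hX, if_pos rfl]
    rw [himage] at hmem
    refine hI.isMonomialIdeal _ hmem _ ?_
    rw [add_assoc, mem_support_iff, coeff_monomial_mul, one_mul, coeff_add_pow_succ hne]
    exact Nat.cast_add_one_ne_zero k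

lemma IsLexIdeal.isMonomialIdeal {I : Ideal (MvPolynomial (Fin m) K)} (hI : IsLexIdeal I) :
    IsMonomialIdeal I := by
  obtain ⟨⟨A, rfl⟩, -⟩ := hI
  exact isMonomialIdeal_monomialIdeal A

lemma IsLexIdeal.isStable {I : Ideal (MvPolynomial (Fin m) K)} (hI : IsLexIdeal I) :
    IsStable (exponentSet I) where
  add_mem _ hα β := add_mem_exponentSet hα β
  move_mem γ i j hij h := by
    refine hI.2 _ (γ + Finsupp.single i 1) (by simp) ⟨j, ?_, fun k hk => ?_⟩ h
    · simp [Finsupp.single_eq_of_ne hij.ne']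
    · simp [Finsupp.single_eq_of_ne hk.ne', Finsupp.single_eq_of_ne (hij.trans hk).ne']

end

open MvPolynomial Filter

/-! ### Removals from the extension of a stable ideal -/

/-- The Gotzmann decompositions of `p` and of its first difference are related by `lowerList`, and
admissibility bounds the exponents: in large degrees `p` is at most the Hilbert function of the
polynomial ring. -/
lemma exists_gotzmann_list {K : Type*} [Field K] {n : ℕ} {p : Polynomial ℚ}
    (hp : IsAdmissible K n p) {r r₁ : ℕ} (hr : IsGotzmannNumber p r)
    (hr₁ : IsGotzmannNumber (firstDiff p) r₁) :
    ∃ a : List ℕ, a.Pairwise (· ≥ ·) ∧ a.length = r ∧ (lowerList a).length = r₁ ∧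
      (∀ d : ℕ, r ≤ d + 1 → p.eval (d : ℚ) = gotzmannFunction a d) ∧
      (∀ᶠ d : ℕ in atTop, (firstDiff p).eval (d : ℚ) = gotzmannFunction (lowerList a) d) ∧
      (a = [n] ∨ ∀ x ∈ a, x < n) := by
  obtain ⟨a, ha, hlen, hpa⟩ := hr.exists_list
  obtain ⟨b, hb, hblen, hpb⟩ := hr₁.exists_list
  have hab : b = lowerList a := by
    refine gotzmannFunction_eventually_injective hb (pairwise_lowerList ha) ?_
    refine eventually_atTop.2 ⟨r + r₁ + 1, fun t ht => ?_⟩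
    obtain ⟨t, rfl⟩ : ∃ s, t = s + 1 := ⟨t - 1, by omega⟩
    have h1 := hpa t (by omega)
    have h2 := hpa (t + 1) (by omega)
    have h3 := hpb (t + 1) (by omega)
    have h4 := gotzmannFunction_succ_of_length_le ha (d := t) (by omega)
    rw [firstDiff, Polynomial.eval_sub, Polynomial.eval_comp, h2, h4] at h3
    simp only [Polynomial.eval_sub, Polynomial.eval_X, Polynomial.eval_one, Nat.cast_add,
      Nat.cast_one, add_sub_cancel_right, h1] at h3
    have h5 : ((gotzmannFunction (lowerList a) (t + 1) : ℕ) : ℚ) =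
        gotzmannFunction b (t + 1) := by linarith
    exact_mod_cast h5.symm
  subst hab
  refine ⟨a, ha, hlen, hblen, hpa, eventually_atTop.2 ⟨r₁, fun d hd => hpb d (by omega)⟩, ?_⟩
  obtain ⟨I, -, hI⟩ := hp
  refine gotzmannFunction_eventually_le_choose ha ?_
  filter_upwards [hI, eventually_ge_atTop r] with t ht htr
  rw [hpa t (by omega), Nat.cast_inj] at ht
  rw [ht]
  exact hilbertFunction_le_choose I t

lemma isHilbertPolynomial_saturation_iff {K : Type*} [Field K] {n r : ℕ} {p : Polynomial ℚ}
    {a : List ℕ} (hpa : ∀ d : ℕ, r ≤ d + 1 → p.eval (d : ℚ) = gotzmannFunction a d)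
    (B : Finset (Fin (n + 1) →₀ ℕ)) :
    IsHilbertPolynomial (saturation (monomialIdeal K (B : Set (Fin (n + 1) →₀ ℕ)))) p ↔
      ∀ᶠ t in atTop, hilbertCount (satSet (upSet B)) t = gotzmannFunction a t := by
  have hmon := isMonomialIdeal_monomialIdeal (K := K) (B : Set (Fin (n + 1) →₀ ℕ))
  have hexp : exponentSet (monomialIdeal K (B : Set (Fin (n + 1) →₀ ℕ))) = upSet B := by
    ext α
    rw [mem_exponentSet_monomialIdeal]
    rfl
  refine eventually_congr ((eventually_ge_atTop r).mono fun t ht => ?_)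
  rw [hpa t (by omega), (isMonomialIdeal_saturation hmon).hilbertFunction_eq,
    exponentSet_saturation hmon, hexp, Nat.cast_inj, eq_comm]

section Removal

variable {n r : ℕ} {a : List ℕ} {U : Set (Fin n →₀ ℕ)} {A : Finset (Fin (n + 1) →₀ ℕ)}

lemma card_pos_sdiff {W : Set (Fin (n + 1) →₀ ℕ)} (hA : ∀ α, α ∈ A ↔ α.degree = r ∧ α ∈ W) :
    (pos n r \ A).card = hilbertCount W r := by
  classical
  unfold hilbertCount
  congr 1
  ext α
  rw [Finset.mem_sdiff, Finset.mem_filter, mem_pos, hA, mem_finsuppAntidiag_univ]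
  tauto

lemma isBorelSet_of_isStable {W : Set (Fin (n + 1) →₀ ℕ)} (hW : IsStable W)
    (hA : ∀ α, α ∈ A ↔ α.degree = r ∧ α ∈ W) : IsBorelSet r A := by
  refine ⟨fun α hα => mem_pos.2 ((hA α).1 hα).1, fun α hα i hi => ?_⟩
  obtain ⟨hd, hαW⟩ := (hA α).1 hα
  obtain ⟨γ, rfl⟩ := exists_eq_add_single hi
  rw [add_tsub_cancel_right, hA]
  rw [map_add, Finsupp.degree_single] at hd
  refine ⟨by rw [map_add, Finsupp.degree_single, hd], ?_⟩
  exact hW.move_mem _ _ _ (Fin.castSucc_lt_succ) hαW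

/-- The multiples of `x_0` in the degree `d + 1` piece of a saturated ideal correspond to its
degree `d` piece. -/
lemma hilbertCount_add_card_filter {W : Set (Fin (n + 1) →₀ ℕ)} {d : ℕ} (hW : IsStable W)
    (hsat : satSet W ⊆ W) (hA : ∀ α, α ∈ A ↔ α.degree = d + 1 ∧ α ∈ W) :
    hilbertCount W d + (A.filter fun α => α 0 ≠ 0).card = (d + n).choose n := by
  classical
  have hcard : (A.filter fun α => α 0 ≠ 0).card =
      ((Finset.univ.finsuppAntidiag d).filter (· ∈ W)).card := by
    rw [← Finset.card_map (s := (Finset.univ.finsuppAntidiag d).filter (· ∈ W))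
      (addRightEmbedding (Finsupp.single 0 1))]
    congr 1
    ext α
    simp only [Finset.mem_filter, Finset.mem_map, mem_finsuppAntidiag_univ, hA,
      addRightEmbedding_apply]
    constructor
    · rintro ⟨⟨hd, hα⟩, h0⟩
      obtain ⟨γ, rfl⟩ := exists_eq_add_single h0
      rw [map_add, Finsupp.degree_single] at hd
      exact ⟨γ, ⟨by omega, mem_of_add_single_zero_mem hW hsat hα⟩, rfl⟩
    · rintro ⟨γ, ⟨hd, hγ⟩, rfl⟩
      exact ⟨⟨by simp [hd], hW.add_mem _ hγ _⟩, by simp⟩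
  rw [hcard, ← hilbertCount_empty, hilbertCount, hilbertCount, add_comm,
    Finset.card_filter_add_card_filter_not]
  simp

/-- The bound on the number of monomials outside of the extension of `U`. -/
lemma gotzmannFunction_le_hilbertCount_coneSet (hU : IsStable U) (hsat : satSet U ⊆ U)
    (ha : a.Pairwise (· ≥ ·))
    (hUa : ∀ᶠ t in atTop, hilbertCount U t = gotzmannFunction (lowerList a) t) :
    gotzmannFunction a a.length + (lowerList a).length ≤
      hilbertCount (coneSet U) a.length + a.length := by
  have hbound := (hilbertCount_bounds hU hsat (pairwise_lowerList ha) hUa).1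
  have hlen := length_lowerList_le a
  have hsum : ∑ j ∈ Finset.range (a.length + 1), gotzmannFunction (lowerList a) j ≤
      ∑ j ∈ Finset.range (a.length + 1), hilbertCount U j :=
    Finset.sum_le_sum fun j _ => hbound j
  rw [gotzmannFunction_eq_sum_lowerList ha, hilbertCount_coneSet]
  omega

lemma IsBorelSet.card_sdiff_add {W : Set (Fin (n + 1) →₀ ℕ)} (ha : a.Pairwise (· ≥ ·))
    (hA : ∀ α, α ∈ A ↔ α.degree = a.length ∧ α ∈ W) {B : Finset (Fin (n + 1) →₀ ℕ)}
    (hB : IsBorelSet a.length B) (hBA : B ⊆ A)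
    (hBa : ∀ᶠ t in atTop, hilbertCount (satSet (upSet B)) t = gotzmannFunction a t) :
    (A \ B).card + hilbertCount W a.length = gotzmannFunction a a.length := by
  have hreg := (hilbertCount_bounds hB.isStable_upSet.satSet
    (satSet_satSet_subset hB.isStable_upSet) ha hBa).2.1 a.length (by omega)
  have hApos : A ⊆ pos n a.length := fun α hα => mem_pos.2 ((hA α).1 hα).1
  rw [← hreg, hB.hilbertCount_satSet, ← card_pos_sdiff hA,
    Finset.card_sdiff_of_subset hBA, Finset.card_sdiff_of_subset hApos,
    Finset.card_sdiff_of_subset (hBA.trans hApos)]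
  have h1 := Finset.card_le_card hBA
  have h2 := Finset.card_le_card hApos
  omega

/-- If the extension of `U` has no more monomials outside of it than the Hilbert polynomial
prescribes, the difference can be removed: there are enough multiples of `x_0`. -/
lemma exists_isBorelSet_of_le (hU : IsStable U) (hsat : satSet U ⊆ U) (ha : a.Pairwise (· ≥ ·))
    (hUa : ∀ᶠ t in atTop, hilbertCount U t = gotzmannFunction (lowerList a) t)
    (han : a = [n] ∨ ∀ x ∈ a, x < n) (hA : ∀ α, α ∈ A ↔ α.degree = a.length ∧ α ∈ coneSet U)
    (hle : hilbertCount (coneSet U) a.length ≤ gotzmannFunction a a.length) :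
    ∃ B ⊆ A, IsBorelSet a.length B ∧
      ∀ᶠ t in atTop, hilbertCount (satSet (upSet B)) t = gotzmannFunction a t := by
  obtain ⟨-, hreg, hgen⟩ := hilbertCount_bounds hU hsat (pairwise_lowerList ha) hUa
  have hlen := length_lowerList_le a
  have hW := hU.coneSet
  have hWsat := satSet_coneSet_subset hU
  -- beyond the Gotzmann number both functions have the same differences
  have hstep : ∀ d, a.length ≤ d + 1 → hilbertCount (coneSet U) (d + 1) + gotzmannFunction a d =
      hilbertCount (coneSet U) d + gotzmannFunction a (d + 1) := by
    intro d hd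
    rw [hilbertCount_coneSet, hilbertCount_coneSet, Finset.sum_range_succ,
      hreg (d + 1) (by omega), gotzmannFunction_succ_of_length_le ha hd]
    omega
  have hk : gotzmannFunction a a.length - hilbertCount (coneSet U) a.length ≤
      (A.filter fun α => α 0 ≠ 0).card := by
    rcases hd : a.length with _ | d
    · rw [List.length_eq_zero_iff.1 hd]
      simp
    · have h1 := hilbertCount_add_card_filter hW hWsat (d := d) (hd ▸ hA)
      have h2 := hstep d (by omega)
      have h3 := gotzmannFunction_le_choose han d
      omega
  obtain ⟨B, hBA, hB, hcard, hzero⟩ := (isBorelSet_of_isStable hW hA).exists_removal hk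
  refine ⟨B, hBA, hB, eventually_atTop.2 ⟨a.length, fun t ht => ?_⟩⟩
  obtain ⟨s, rfl⟩ := Nat.exists_eq_add_of_le ht
  rw [hB.hilbertCount_removal hW hWsat (hgen.mono hlen).coneSet hA hBA hzero, hcard]
  have hdiff : ∀ s, hilbertCount (coneSet U) (a.length + s) + gotzmannFunction a a.length =
      hilbertCount (coneSet U) a.length + gotzmannFunction a (a.length + s) := by
    intro s
    induction s with
    | zero => rfl
    | succ s ih =>
      have := hstep (a.length + s) (by omega)
      rw [← add_assoc]
      omega
  have := hdiff s
  omega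

/-- For a lexicographic ideal the number of monomials outside of its extension is as small as the
bound permits. -/
lemma hilbertCount_coneSet_le_of_lex (hU : IsStable U) (hsat : satSet U ⊆ U)
    (ha : a.Pairwise (· ≥ ·))
    (hUa : ∀ᶠ t in atTop, hilbertCount U t = gotzmannFunction (lowerList a) t)
    (han : a = [n] ∨ ∀ x ∈ a, x < n)
    (hlex : ∀ α β : Fin n →₀ ℕ, α.degree = β.degree → LexGT α β → β ∈ U → α ∈ U) :
    hilbertCount (coneSet U) a.length + a.length ≤
      gotzmannFunction a a.length + (lowerList a).length := by
  have hle : ∀ d, hilbertCount U d ≤ gotzmannFunction (lowerList a) d := by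
    by_cases hsmall : ∀ x ∈ lowerList a, x + 1 < n
    · exact hilbertCount_le_of_lex hU hsat (pairwise_lowerList ha) hsmall hlex hUa
    · -- the Hilbert polynomial is that of the whole polynomial ring
      have han' : a = [n] := han.resolve_right fun h =>
        hsmall fun x hx => h _ (mem_lowerList.1 hx)
      subst han'
      cases n with
      | zero => exact absurd (by simp [lowerList]) hsmall
      | succ n =>
        intro d
        rw [lowerList, lowerList, gotzmannFunction_singleton, ← hilbertCount_empty]
        exact hilbertCount_anti (Set.empty_subset U) d
  have hlen := length_lowerList_le a
  have hsum : ∑ j ∈ Finset.range (a.length + 1), hilbertCount U j ≤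
      ∑ j ∈ Finset.range (a.length + 1), gotzmannFunction (lowerList a) j :=
    Finset.sum_le_sum fun j _ => hle j
  rw [gotzmannFunction_eq_sum_lowerList ha, hilbertCount_coneSet]
  omega

end Removal

end BorelRemoval

end

open BorelRemoval
theorem mainTheorem3 {K : Type*} [Field K] [CharZero K] (n : ℕ) (p : Polynomial ℚ)
    (hp : IsAdmissible K n p) (r r₁ : ℕ) (hr : IsGotzmannNumber p r)
    (hr₁ : IsGotzmannNumber (firstDiff p) r₁) :
    (∀ J : Ideal (MvPolynomial (Fin n) K), IsBorelFixed J → IsSaturated J →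
      IsHilbertPolynomial J (firstDiff p) →
        (p.eval (r : ℚ) - ((pos n r \ monomialsIn (extendIdeal J) r).card : ℚ) ≤ (r : ℚ) - (r₁ : ℚ)) ∧
        ((∃ B ⊆ monomialsIn (extendIdeal J) r, IsBorelSetFor K p r B) ↔
          0 ≤ p.eval (r : ℚ) - ((pos n r \ monomialsIn (extendIdeal J) r).card : ℚ)) ∧
        (∀ B ⊆ monomialsIn (extendIdeal J) r, IsBorelSetFor K p r B →
          ((monomialsIn (extendIdeal J) r \ B).card : ℚ) =
              p.eval (r : ℚ) - ((pos n r \ monomialsIn (extendIdeal J) r).card : ℚ) ∧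
            (monomialsIn (extendIdeal J) r \ B).card + r₁ ≤ r)) ∧
    (∀ L : Ideal (MvPolynomial (Fin n) K), IsLexIdeal L → IsSaturated L →
      IsHilbertPolynomial L (firstDiff p) →
        (∃ B ⊆ monomialsIn (extendIdeal L) r, IsBorelSetFor K p r B) ∧
        (∀ B ⊆ monomialsIn (extendIdeal L) r, IsBorelSetFor K p r B →
          (monomialsIn (extendIdeal L) r \ B).card + r₁ = r)) := by
  obtain ⟨a, ha, rfl, rfl, hpa, hdiff, han⟩ := exists_gotzmann_list hp hr hr₁
  have hlen := length_lowerList_le a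
  have hcount : ∀ J : Ideal (MvPolynomial (Fin n) K), IsMonomialIdeal J →
      IsHilbertPolynomial J (firstDiff p) →
      ∀ᶠ t in Filter.atTop, hilbertCount (exponentSet J) t = gotzmannFunction (lowerList a) t := by
    intro J hJ hH
    filter_upwards [hH, hdiff] with t h1 h2
    rw [h2, hJ.hilbertFunction_eq, Nat.cast_inj] at h1
    exact h1.symm
  have hmem : ∀ J : Ideal (MvPolynomial (Fin n) K), IsMonomialIdeal J →
      ∀ α, α ∈ monomialsIn (extendIdeal J) a.length ↔
        α.degree = a.length ∧ α ∈ coneSet (exponentSet J) := by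
    intro J hJ α
    rw [← hJ.exponentSet_extendIdeal]
    simp only [monomialsIn, Finset.mem_filter, mem_pos]
    rfl
  have hfor : ∀ B : Finset (Fin (n + 1) →₀ ℕ), IsBorelSetFor K p a.length B ↔
      IsBorelSet a.length B ∧ ∀ᶠ t in Filter.atTop,
        hilbertCount (satSet (upSet B)) t = gotzmannFunction a t := fun B =>
    and_congr_right fun _ => isHilbertPolynomial_saturation_iff hpa B
  rw [hpa a.length (by omega)]
  simp only [hfor]
  constructor
  · intro J hJ hsat hH
    have hmon := hJ.isMonomialIdeal
    have hst := hJ.isStable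
    have hsat' := hmon.satSet_subset hsat
    have hle := gotzmannFunction_le_hilbertCount_coneSet hst hsat' ha (hcount J hmon hH)
    have hcard := fun B hBA hB hBa =>
      IsBorelSet.card_sdiff_add (B := B) ha (hmem J hmon) hB hBA hBa
    rw [card_pos_sdiff (hmem J hmon)]
    refine ⟨?_, ⟨?_, fun h => ?_⟩, fun B hBA hB => ?_⟩
    · rw [sub_le_sub_iff, add_comm (a.length : ℚ)]
      exact_mod_cast hle
    · rintro ⟨B, hBA, hB, hBa⟩
      have := hcard B hBA hB hBa
      rw [sub_nonneg, Nat.cast_le]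
      omega
    · rw [sub_nonneg, Nat.cast_le] at h
      exact exists_isBorelSet_of_le hst hsat' ha (hcount J hmon hH) han (hmem J hmon) h
    · have h := hcard B hBA hB.1 hB.2
      refine ⟨?_, by omega⟩
      rw [eq_sub_iff_add_eq]
      exact_mod_cast h
  · intro L hL hsat hH
    have hmon := hL.isMonomialIdeal
    have hst := hL.isStable
    have hsat' := hmon.satSet_subset hsat
    have hle := gotzmannFunction_le_hilbertCount_coneSet hst hsat' ha (hcount L hmon hH)
    have hge := hilbertCount_coneSet_le_of_lex hst hsat' ha (hcount L hmon hH) han hL.2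
    refine ⟨exists_isBorelSet_of_le hst hsat' ha (hcount L hmon hH) han (hmem L hmon) (by omega),
      fun B hBA hB => ?_⟩
    have h := IsBorelSet.card_sdiff_add ha (hmem L hmon) hB.1 hBA hB.2
    omega
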